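/- Let $n \ge 1$ be an integer and let $x \in [0,1]$. Then $x$ is $1$-generic if and only if for every computable function $f:[0,1]\to\mathbb{R}$ that is $n$ times differentiable on $[0,1]$, the $n$-th derivative $f^{(n)}:[0,1]\to\mathbb{R}$ is continuous at $x$. Here derivatives and continuity are taken relative to $[0,1]$ (one-sided at the endpoints), and $f^{(n)}$ need not be continuous on $[0,1]$. A set $U\subseteq[0,1]$ is a $\Sigma^0_1$ class if $U=\bigcup_{(q,r)\in W}\,(q,r)\cap[0,1]$ for some computably enumerable set $W$ of pairs of rational numbers; an index of $W$ (with respect to a standard enumeration of the c.e. sets) is an index of $U$. A set $V\subseteq[0,1]$ is a $\Pi^0_1$ class if $[0,1]\setminus V$ is a $\Sigma^0_1$ class. A point $x\in[0,1]$ is $1$-generic if $x\notin V\setminus\mathrm{Int}(V)$ for every $\Pi^0_1$ class $V\subseteq[0,1]$, where the interior is taken in $[0,1]$. A function $f:[0,1]\to\mathbb{R}$ is computable if there is a computable function $\alpha:\mathbb{Q}\times\mathbb{Q}\to\mathbb{N}$ such that, for all $q,r\in\mathbb{Q}$, $\alpha(q,r)$ is an index of $f^{-1}((q,r))$ as a $\Sigma^0_1$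 class. -/

import Mathlib

open Set

namespace EffReal

/-- A triple `(a, b, d)` of natural numbers names the rational number `(a - b) / (d + 1)`. -/
def ratOfCode (t : ℕ × ℕ × ℕ) : ℚ :=
  ((t.1 : ℚ) - (t.2.1 : ℚ)) / ((t.2.2 : ℚ) + 1)

/-- Every rational number has a name. -/
theorem ratOfCode_surjective : Function.Surjective ratOfCode := by
  intro q
  refine ⟨(q.num.toNat, (-q.num).toNat, q.den - 1), ?_⟩
  have hd : ((q.den - 1 : ℕ) : ℚ) + 1 = (q.den : ℚ) := by
    have h : (q.den - 1) + 1 = q.den := Nat.sub_add_cancel q.den_pos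
    exact_mod_cast h
  have hn : ((q.num.toNat : ℕ) : ℚ) - (((-q.num).toNat : ℕ) : ℚ) = (q.num : ℚ) := by
    have h : ((q.num.toNat : ℕ) : ℤ) - (((-q.num).toNat : ℕ) : ℤ) = q.num := by omega
    exact_mod_cast h
  simp only [ratOfCode, hd, hn]
  exact Rat.num_div_den q

/-- Names of pairs of rational numbers (the endpoints of an interval). -/
abbrev PairCode : Type := (ℕ × ℕ × ℕ) × (ℕ × ℕ × ℕ)

/-- The open interval `(q, r)` of the real line whose rational endpoints are named by `p`. -/
def ratIoo (p : PairCode) : Set ℝ :=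
  Ioo ((ratOfCode p.1 : ℚ) : ℝ) ((ratOfCode p.2 : ℚ) : ℝ)

/-- The c.e. set of (names of) pairs of rationals with index `e`: the domain of the `e`-th partial
computable function. -/
def ceSet (e : Nat.Partrec.Code) : Set PairCode :=
  {p | (e.eval (Encodable.encode p)).Dom}

/-- The `Σ⁰₁` class in `[0,1]` with index `e`: the union of the relatively open rational intervals
`(q, r) ∩ [0,1]` with `(q, r)` in the c.e. set with index `e`. -/
def sigmaClass (e : Nat.Partrec.Code) : Set unitInterval :=
  {y | ∃ p ∈ ceSet e, (y : ℝ) ∈ ratIoo p}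

/-- Effectively open subsets of `[0,1]`. -/
def IsSigma01 (U : Set unitInterval) : Prop :=
  ∃ e : Nat.Partrec.Code, U = sigmaClass e

/-- Effectively closed subsets of `[0,1]`. -/
def IsPi01 (V : Set unitInterval) : Prop :=
  IsSigma01 Vᶜ

/-- A point `x` of `[0,1]` is 1-generic if `x ∉ V \ Int V` for every `Π⁰₁` class `V ⊆ [0,1]`
(the interior is taken in the space `[0,1]`). -/
def IsOneGeneric (x : unitInterval) : Prop :=
  ∀ V : Set unitInterval, IsPi01 V → x ∉ V \ interior V

/-- A function `f : [0,1] → ℝ` is computable if there is a computable function sending (names of)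
rationals `q, r` to an index of `f⁻¹((q, r))` as a `Σ⁰₁` class. -/
def IsComputable (f : unitInterval → ℝ) : Prop :=
  ∃ α : PairCode → Nat.Partrec.Code, Computable α ∧
    ∀ p : PairCode, f ⁻¹' ratIoo p = sigmaClass (α p)

/-- The `k`-th derivative of `f : [0,1] → ℝ`, one-sided at the endpoints: the iterated derivative
within `[0,1]`. It depends only on the values of `f` on `[0,1]`; the extension of `f` to the real
line is immaterial. It is meaningful when `f` is `k` times differentiable. -/
noncomputable def nthDeriv (k : ℕ) (f : unitInterval → ℝ) (y : unitInterval) : ℝ :=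
  iteratedDerivWithin k (IccExtend (zero_le_one' ℝ) f) (Icc 0 1) (y : ℝ)

/-- `f : [0,1] → ℝ` is `n` times differentiable on `[0,1]` (one-sided at the endpoints): the
derivatives of order `< n` are differentiable at every point of `[0,1]`. The `n`-th derivative is
not required to be continuous. -/
def NTimesDifferentiable (n : ℕ) (f : unitInterval → ℝ) : Prop :=
  ∀ k < n, DifferentiableOn ℝ
    (iteratedDerivWithin k (IccExtend (zero_le_one' ℝ) f) (Icc 0 1)) (Icc 0 1)

end EffReal

/-! Generic implies continuous. Both semicontinuities of the `n`-th derivative at `x` are needed,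
and passing to `-f` reduces them to one. Take a rational `q` above `f⁽ⁿ⁾(x)`. Wherever `f` is `n`
times differentiable in the interior, the quotients `Δ_h^n f(y) / h^n` tend to `f⁽ⁿ⁾(y)` as `h`
tends to `0` from above, even if `f⁽ⁿ⁾` is discontinuous
(`exists_forall_abs_fwdDiff_iterate_sub_le`). For `d` small, the set `U` of points where some
rational `h` in `(0, d)` gives a quotient above `q` omits `x`, and `U` is effectively open because
`f` is computable (`uniformlySigma_fwdDiff`). Genericity puts a neighbourhood of `x` outside `U`,
and there `f⁽ⁿ⁾ ≤ q`, since a larger derivative would force membership in `U`.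

Continuous implies generic. Suppose `x` lies in a `Π⁰₁` class `V` but not in its interior. Cut the
complement of `V` effectively into disjoint dyadic cells (`Selected`), and put into a cell of level
`s` a copy of `(t(1-t))^(n+1)`, shrunk horizontally by `4^(s+1)` and vertically by its `n`-th power.
The `n`-th derivatives of all copies have the same nonzero range, while the `n`-th derivative of the
sum is `0` at `x`; as cells accumulate at `x`, continuity fails there. Derivatives of lower order
are at most `C / 4^(s+1)`, comparable to the squared gap between a bump and the boundary of its
cell, so they vanish quadratically on `V` and the sum is `n` times differentiable everywhere
(`hasDerivAt_bumpSeries`). It is computable because it is Lipschitz and its value at `k / 2^m` is a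
finite rational expression in the cells of level below `m` (`bumpSeries_dyadic`). -/

namespace EffReal

/-! ### Closure properties of recursively enumerable predicates; uniform indices -/

section Enumerability

variable {α β : Type*} [Primcodable α] [Primcodable β]

/-- A predicate is recursively enumerable iff it is the projection of a primitive recursive
relation. -/
theorem rePred_iff_exists_primrec {p : α → Prop} :
    REPred p ↔ ∃ R : α × ℕ → Prop, PrimrecPred R ∧ ∀ a, p a ↔ ∃ k, R (a, k) := by
  constructor
  · intro h
    obtain ⟨c, hc⟩ := Nat.Partrec.Code.exists_code.1 h
    refine ⟨fun x => (Nat.Partrec.Code.evaln x.2 c (Encodable.encode x.1)).isSome = true, ?_, ?_⟩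
    · refine Primrec.eq.comp (Primrec.option_isSome.comp ?_) (Primrec.const true)
      exact Nat.Partrec.Code.primrec_evaln.comp
        ((Primrec.snd.pair (Primrec.const c)).pair (Primrec.encode.comp Primrec.fst))
    · intro a
      have h1 : p a ↔ (c.eval (Encodable.encode a)).Dom := by
        rw [hc]; simp [Part.assert]
      rw [h1, Part.dom_iff_mem]
      simp only [Nat.Partrec.Code.evaln_complete, Option.isSome_iff_exists, Option.mem_def]
      exact exists_comm
  · rintro ⟨R, ⟨hd, hR⟩, h⟩
    have hf : Partrec₂ fun (a : α) (k : ℕ) => (Part.some (decide (R (a, k))) : Part Bool) :=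
      (hR.to_comp.to₂).partrec₂
    refine (Partrec.dom_re (Partrec.rfind hf)).of_eq fun a => ?_
    refine Iff.trans Nat.rfind_dom' (Iff.trans ?_ (h a).symm)
    simp

theorem _root_.PrimrecPred.rePred {p : α → Prop} (h : PrimrecPred p) : REPred p :=
  rePred_iff_exists_primrec.2 ⟨fun x => p x.1, h.comp Primrec.fst, fun a => by simp⟩

theorem _root_.REPred.and {p q : α → Prop} (hp : REPred p) (hq : REPred q) :
    REPred fun a => p a ∧ q a := by
  obtain ⟨R, hR, hp⟩ := rePred_iff_exists_primrec.1 hp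
  obtain ⟨S, hS, hq⟩ := rePred_iff_exists_primrec.1 hq
  refine rePred_iff_exists_primrec.2
    ⟨fun x => R (x.1, x.2.unpair.1) ∧ S (x.1, x.2.unpair.2), ?_, fun a => ?_⟩
  · refine PrimrecPred.and (hR.comp ?_) (hS.comp ?_)
    · exact Primrec.fst.pair (Primrec.fst.comp (Primrec.unpair.comp Primrec.snd))
    · exact Primrec.fst.pair (Primrec.snd.comp (Primrec.unpair.comp Primrec.snd))
  · rw [hp, hq]
    constructor
    · rintro ⟨⟨i, hi⟩, j, hj⟩
      exact ⟨Nat.pair i j, by simpa using ⟨hi, hj⟩⟩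
    · rintro ⟨k, h1, h2⟩
      exact ⟨⟨_, h1⟩, _, h2⟩

theorem _root_.REPred.exists {p : α × β → Prop} (hp : REPred p) : REPred fun a => ∃ b, p (a, b) := by
  obtain ⟨R, ⟨hd, hR⟩, hp⟩ := rePred_iff_exists_primrec.1 hp
  refine rePred_iff_exists_primrec.2
    ⟨fun x => ((Encodable.decode x.2.unpair.1 : Option β).map
      fun b => decide (R ((x.1, b), x.2.unpair.2))) = some true, ?_, fun a => ?_⟩
  · refine Primrec.eq.comp (Primrec.option_map ?_ ?_) (Primrec.const (some true))
    · exact Primrec.decode.comp (Primrec.fst.comp (Primrec.unpair.comp Primrec.snd))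
    · exact hR.comp (((Primrec.fst.comp Primrec.fst).pair Primrec.snd).pair
        (Primrec.snd.comp (Primrec.unpair.comp (Primrec.snd.comp Primrec.fst))))
  · simp only [hp, Option.map_eq_some_iff, decide_eq_true_eq]
    constructor
    · rintro ⟨b, k, h⟩
      exact ⟨Nat.pair (Encodable.encode b) k, b, by simpa using h⟩
    · rintro ⟨k, b, -, h⟩
      exact ⟨b, _, h⟩

theorem _root_.REPred.comp {p : β → Prop} {f : α → β} (hp : REPred p) (hf : Computable f) :
    REPred fun a => p (f a) :=
  Partrec.comp hp hf

theorem rePred_mem_ceSet : REPred fun x : Nat.Partrec.Code × PairCode => x.2 ∈ ceSet x.1 :=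
  Partrec.dom_re (Nat.Partrec.Code.eval_part.comp Computable.fst
    (Computable.encode.comp Computable.snd))

/-- A recursively enumerable family of sets of pair names is uniformly indexed. -/
theorem exists_computable_ceSet {R : α × PairCode → Prop} (hR : REPred R) :
    ∃ g : α → Nat.Partrec.Code, Computable g ∧ ∀ a, ceSet (g a) = {p | R (a, p)} := by
  obtain ⟨c, hc⟩ := Nat.Partrec.Code.exists_code.1 hR
  -- This is the s-m-n theorem: fixing the parameter in the code is primitive recursive in the
  -- parameter.
  refine ⟨fun a => Nat.Partrec.Code.curry c (Encodable.encode a),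
    (Nat.Partrec.Code.primrec₂_curry.comp (Primrec.const c) Primrec.encode).to_comp, fun a => ?_⟩
  ext p
  have h1 : Nat.pair (Encodable.encode a) (Encodable.encode p) = Encodable.encode (a, p) := rfl
  change (Nat.Partrec.Code.eval _ _).Dom ↔ R (a, p)
  rw [Nat.Partrec.Code.eval_curry, h1, hc]
  simp only [Encodable.encodek]
  simp [Part.assert]

end Enumerability

/-! ### Primitive recursive arithmetic and order on names of rationals -/

section RationalCodes

variable {α β : Type*} [Primcodable α] [Primcodable β]

/-- A rational-valued function is primitive recursive if names of its values can be found by a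
primitive recursive function. -/
def PrimrecRat (f : α → ℚ) : Prop :=
  ∃ g : α → ℕ × ℕ × ℕ, Primrec g ∧ ∀ a, ratOfCode (g a) = f a

theorem primrecRat_ratOfCode : PrimrecRat ratOfCode := ⟨id, Primrec.id, fun _ => rfl⟩

namespace PrimrecRat

theorem of_eq {f g : α → ℚ} (hf : PrimrecRat f) (h : ∀ a, f a = g a) : PrimrecRat g := by
  obtain ⟨F, hF, h1⟩ := hf
  exact ⟨F, hF, fun a => (h1 a).trans (h a)⟩

theorem comp {f : β → ℚ} {g : α → β} (hf : PrimrecRat f) (hg : Primrec g) :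
    PrimrecRat fun a => f (g a) := by
  obtain ⟨F, hF, h⟩ := hf
  exact ⟨fun a => F (g a), hF.comp hg, fun a => h _⟩

theorem natCast {f : α → ℕ} (hf : Primrec f) : PrimrecRat fun a => (f a : ℚ) :=
  ⟨fun a => (f a, 0, 0), hf.pair (Primrec.const (0, 0)), fun a => by simp [ratOfCode]⟩

theorem const (q : ℚ) : PrimrecRat fun _ : α => q := by
  obtain ⟨t, ht⟩ := ratOfCode_surjective q
  exact ⟨fun _ => t, Primrec.const t, fun _ => ht⟩

theorem neg {f : α → ℚ} (hf : PrimrecRat f) : PrimrecRat fun a => -f a := by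
  obtain ⟨F, hF, h⟩ := hf
  refine ⟨fun a => ((F a).2.1, (F a).1, (F a).2.2), ?_, fun a => ?_⟩
  · exact (Primrec.fst.comp (Primrec.snd.comp hF)).pair
      ((Primrec.fst.comp hF).pair (Primrec.snd.comp (Primrec.snd.comp hF)))
  · beta_reduce
    rw [← h]; simp only [ratOfCode]; ring

theorem add {f g : α → ℚ} (hf : PrimrecRat f) (hg : PrimrecRat g) :
    PrimrecRat fun a => f a + g a := by
  obtain ⟨F, hF, h⟩ := hf
  obtain ⟨G, hG, h'⟩ := hg
  have f1 := Primrec.fst.comp hF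
  have f2 := Primrec.fst.comp (Primrec.snd.comp hF)
  have f3 := Primrec.snd.comp (Primrec.snd.comp hF)
  have g1 := Primrec.fst.comp hG
  have g2 := Primrec.fst.comp (Primrec.snd.comp hG)
  have g3 := Primrec.snd.comp (Primrec.snd.comp hG)
  -- A name stores the denominator minus one, and `(d + 1)(d' + 1) - 1 = d d' + d + d'`.
  refine ⟨fun a => ((F a).1 * ((G a).2.2 + 1) + (G a).1 * ((F a).2.2 + 1),
    (F a).2.1 * ((G a).2.2 + 1) + (G a).2.1 * ((F a).2.2 + 1),
    (F a).2.2 * (G a).2.2 + (F a).2.2 + (G a).2.2), ?_, fun a => ?_⟩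
  · refine Primrec.pair ?_ (Primrec.pair ?_ ?_)
    · exact Primrec.nat_add.comp (Primrec.nat_mul.comp f1 (Primrec.succ.comp g3))
        (Primrec.nat_mul.comp g1 (Primrec.succ.comp f3))
    · exact Primrec.nat_add.comp (Primrec.nat_mul.comp f2 (Primrec.succ.comp g3))
        (Primrec.nat_mul.comp g2 (Primrec.succ.comp f3))
    · exact Primrec.nat_add.comp (Primrec.nat_add.comp (Primrec.nat_mul.comp f3 g3) f3) g3
  · beta_reduce
    rw [← h, ← h']
    simp only [ratOfCode]
    have e1 : ((F a).2.2 : ℚ) + 1 ≠ 0 := by positivity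
    have e2 : ((G a).2.2 : ℚ) + 1 ≠ 0 := by positivity
    have e3 : (((F a).2.2 * (G a).2.2 + (F a).2.2 + (G a).2.2 : ℕ) : ℚ) + 1
        = (((F a).2.2 : ℚ) + 1) * (((G a).2.2 : ℚ) + 1) := by push_cast; ring
    rw [e3]
    push_cast
    field_simp
    ring

theorem mul {f g : α → ℚ} (hf : PrimrecRat f) (hg : PrimrecRat g) :
    PrimrecRat fun a => f a * g a := by
  obtain ⟨F, hF, h⟩ := hf
  obtain ⟨G, hG, h'⟩ := hg
  have f1 := Primrec.fst.comp hF
  have f2 := Primrec.fst.comp (Primrec.snd.comp hF)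
  have f3 := Primrec.snd.comp (Primrec.snd.comp hF)
  have g1 := Primrec.fst.comp hG
  have g2 := Primrec.fst.comp (Primrec.snd.comp hG)
  have g3 := Primrec.snd.comp (Primrec.snd.comp hG)
  refine ⟨fun a => ((F a).1 * (G a).1 + (F a).2.1 * (G a).2.1,
    (F a).1 * (G a).2.1 + (F a).2.1 * (G a).1,
    (F a).2.2 * (G a).2.2 + (F a).2.2 + (G a).2.2), ?_, fun a => ?_⟩
  · refine Primrec.pair ?_ (Primrec.pair ?_ ?_)
    · exact Primrec.nat_add.comp (Primrec.nat_mul.comp f1 g1) (Primrec.nat_mul.comp f2 g2)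
    · exact Primrec.nat_add.comp (Primrec.nat_mul.comp f1 g2) (Primrec.nat_mul.comp f2 g1)
    · exact Primrec.nat_add.comp (Primrec.nat_add.comp (Primrec.nat_mul.comp f3 g3) f3) g3
  · beta_reduce
    rw [← h, ← h']
    simp only [ratOfCode]
    have e1 : ((F a).2.2 : ℚ) + 1 ≠ 0 := by positivity
    have e2 : ((G a).2.2 : ℚ) + 1 ≠ 0 := by positivity
    have e3 : (((F a).2.2 * (G a).2.2 + (F a).2.2 + (G a).2.2 : ℕ) : ℚ) + 1
        = (((F a).2.2 : ℚ) + 1) * (((G a).2.2 : ℚ) + 1) := by push_cast; ring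
    rw [e3]
    push_cast
    field_simp
    ring

theorem sub {f g : α → ℚ} (hf : PrimrecRat f) (hg : PrimrecRat g) :
    PrimrecRat fun a => f a - g a :=
  (hf.add hg.neg).of_eq fun _ => (sub_eq_add_neg _ _).symm

theorem pow {f : α → ℚ} (hf : PrimrecRat f) (n : ℕ) : PrimrecRat fun a => f a ^ n := by
  induction n with
  | zero => exact (const 1).of_eq fun _ => (pow_zero _).symm
  | succ n ih => exact (ih.mul hf).of_eq fun a => (pow_succ _ _).symm

theorem one_div_two_pow {f : α → ℕ} (hf : Primrec f) : PrimrecRat fun a => (1 / 2 ^ f a : ℚ) := by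
  have hp : Primrec fun a => 2 ^ f a :=
    (Primrec₂.unpaired'.1 Nat.Primrec.pow).comp (Primrec.const 2) hf
  refine ⟨fun a => (1, 0, 2 ^ f a - 1),
    (Primrec.const 1).pair ((Primrec.const 0).pair (Primrec.nat_sub.comp hp (Primrec.const 1))),
    fun a => ?_⟩
  have h1 : 1 ≤ 2 ^ f a := Nat.one_le_two_pow
  simp [ratOfCode, Nat.cast_sub h1]

theorem ite {c : α → Prop} [DecidablePred c] {f g : α → ℚ} (hc : PrimrecPred c)
    (hf : PrimrecRat f) (hg : PrimrecRat g) : PrimrecRat fun a => if c a then f a else g a := by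
  obtain ⟨F, hF, h⟩ := hf
  obtain ⟨G, hG, h'⟩ := hg
  refine ⟨fun a => if c a then F a else G a, Primrec.ite hc hF hG, fun a => ?_⟩
  by_cases hca : c a <;> simp [hca, h, h']

theorem le {f g : α → ℚ} (hf : PrimrecRat f) (hg : PrimrecRat g) :
    PrimrecPred fun a => f a ≤ g a := by
  obtain ⟨F, hF, h⟩ := hf.sub hg
  refine PrimrecPred.of_eq (p := fun a => (F a).1 ≤ (F a).2.1)
    (Primrec.nat_le.comp (Primrec.fst.comp hF) (Primrec.fst.comp (Primrec.snd.comp hF)))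
    fun a => ?_
  have h3 : (0 : ℚ) < ((F a).2.2 : ℚ) + 1 := by positivity
  have h4 : ratOfCode (F a) = f a - g a := h a
  rw [← sub_nonpos (a := f a), ← h4, ratOfCode, div_nonpos_iff]
  constructor
  · intro h4
    have : ((F a).1 : ℚ) ≤ (F a).2.1 := by exact_mod_cast h4
    exact Or.inr ⟨by linarith, h3.le⟩
  · rintro (⟨-, h5⟩ | ⟨h5, -⟩)
    · linarith
    · have : ((F a).1 : ℚ) ≤ (F a).2.1 := by linarith
      exact_mod_cast this

theorem lt {f g : α → ℚ} (hf : PrimrecRat f) (hg : PrimrecRat g) :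
    PrimrecPred fun a => f a < g a :=
  (hg.le hf).not.of_eq fun _ => not_le

theorem eq {f g : α → ℚ} (hf : PrimrecRat f) (hg : PrimrecRat g) :
    PrimrecPred fun a => f a = g a :=
  ((hf.le hg).and (hg.le hf)).of_eq fun _ => le_antisymm_iff.symm

theorem max {f g : α → ℚ} (hf : PrimrecRat f) (hg : PrimrecRat g) :
    PrimrecRat fun a => max (f a) (g a) :=
  (ite (hf.le hg) hg hf).of_eq fun a => (max_def (f a) (g a)).symm

theorem sum_range {f : α → ℕ → ℚ} {N : α → ℕ} (hf : PrimrecRat fun x : α × ℕ => f x.1 x.2)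
    (hN : Primrec N) : PrimrecRat fun a => ∑ i ∈ Finset.range (N a), f a i := by
  obtain ⟨A, hA, hA'⟩ := ((primrecRat_ratOfCode.comp Primrec.fst).add
    (primrecRat_ratOfCode.comp Primrec.snd) :
      PrimrecRat fun x : (ℕ × ℕ × ℕ) × (ℕ × ℕ × ℕ) => ratOfCode x.1 + ratOfCode x.2)
  obtain ⟨F, hF, h⟩ := hf
  refine ⟨fun a => Nat.rec (0, 0, 0) (fun i s => A (s, F (a, i))) (N a), ?_, fun a => ?_⟩
  · exact Primrec.nat_rec' (h := fun a x => A (x.2, F (a, x.1))) hN (Primrec.const (0, 0, 0))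
      (hA.comp ((Primrec.snd.comp Primrec.snd).pair
        (hF.comp (Primrec.fst.pair (Primrec.fst.comp Primrec.snd)))))
  · beta_reduce
    generalize N a = M
    induction M with
    | zero => simp [ratOfCode]
    | succ M ih => rw [Finset.sum_range_succ, hA', ← ih]; exact congrArg _ (h _)

end PrimrecRat

end RationalCodes

/-! ### Uniformly effectively open families and the forward differences of a computable function -/

section UniformFamilies

variable {α β : Type*} [Primcodable α] [Primcodable β]

/-- A family of subsets of the real line is uniformly effectively open if its members are unions of
uniformly recursively enumerable families of rational intervals. -/
def UniformlySigma (S : α → Set ℝ) : Prop :=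
  ∃ R : α × PairCode → Prop, REPred R ∧ ∀ a y, y ∈ S a ↔ ∃ p, R (a, p) ∧ y ∈ ratIoo p

theorem exists_pairCode (a b : ℚ) : ∃ p : PairCode, ratOfCode p.1 = a ∧ ratOfCode p.2 = b := by
  obtain ⟨s, hs⟩ := ratOfCode_surjective a
  obtain ⟨t, ht⟩ := ratOfCode_surjective b
  exact ⟨(s, t), hs, ht⟩

theorem mem_ratIoo {p : PairCode} {y : ℝ} :
    y ∈ ratIoo p ↔ (ratOfCode p.1 : ℝ) < y ∧ y < (ratOfCode p.2 : ℝ) := Iff.rfl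

namespace UniformlySigma

theorem of_eq {S T : α → Set ℝ} (hS : UniformlySigma S) (h : ∀ a y, y ∈ S a ↔ y ∈ T a) :
    UniformlySigma T := by
  obtain ⟨R, hR, hS⟩ := hS
  exact ⟨R, hR, fun a y => (h a y).symm.trans (hS a y)⟩

theorem comp {S : β → Set ℝ} {f : α → β} (hS : UniformlySigma S) (hf : Computable f) :
    UniformlySigma fun a => S (f a) := by
  obtain ⟨R, hR, hS⟩ := hS
  exact ⟨fun x => R (f x.1, x.2), hR.comp ((hf.comp Computable.fst).pair Computable.snd),
    fun a y => hS _ y⟩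

/-- Every rational interval contained in one interval from each family is enumerated; the overlap of
two such intervals is itself among them. -/
theorem inter {S T : α → Set ℝ} (hS : UniformlySigma S) (hT : UniformlySigma T) :
    UniformlySigma fun a => S a ∩ T a := by
  obtain ⟨Q, hQ, hS⟩ := hS
  obtain ⟨R, hR, hT⟩ := hT
  have r1 : PrimrecRat fun x : (α × PairCode) × (PairCode × PairCode) => ratOfCode x.1.2.1 :=
    primrecRat_ratOfCode.comp (Primrec.fst.comp (Primrec.snd.comp Primrec.fst))
  have r2 : PrimrecRat fun x : (α × PairCode) × (PairCode × PairCode) => ratOfCode x.1.2.2 :=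
    primrecRat_ratOfCode.comp (Primrec.snd.comp (Primrec.snd.comp Primrec.fst))
  have s1 : PrimrecRat fun x : (α × PairCode) × (PairCode × PairCode) => ratOfCode x.2.1.1 :=
    primrecRat_ratOfCode.comp (Primrec.fst.comp (Primrec.fst.comp Primrec.snd))
  have s2 : PrimrecRat fun x : (α × PairCode) × (PairCode × PairCode) => ratOfCode x.2.1.2 :=
    primrecRat_ratOfCode.comp (Primrec.snd.comp (Primrec.fst.comp Primrec.snd))
  have t1 : PrimrecRat fun x : (α × PairCode) × (PairCode × PairCode) => ratOfCode x.2.2.1 :=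
    primrecRat_ratOfCode.comp (Primrec.fst.comp (Primrec.snd.comp Primrec.snd))
  have t2 : PrimrecRat fun x : (α × PairCode) × (PairCode × PairCode) => ratOfCode x.2.2.2 :=
    primrecRat_ratOfCode.comp (Primrec.snd.comp (Primrec.snd.comp Primrec.snd))
  have hQ' : REPred fun x : (α × PairCode) × (PairCode × PairCode) => Q (x.1.1, x.2.1) :=
    hQ.comp ((Primrec.fst.comp Primrec.fst).pair (Primrec.fst.comp Primrec.snd)).to_comp
  have hR' : REPred fun x : (α × PairCode) × (PairCode × PairCode) => R (x.1.1, x.2.2) :=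
    hR.comp ((Primrec.fst.comp Primrec.fst).pair (Primrec.snd.comp Primrec.snd)).to_comp
  refine ⟨_, ((hQ'.and hR').and (((s1.le r1).and (t1.le r1)).and
    ((r2.le s2).and (r2.le t2))).rePred).exists, fun a y => ?_⟩
  rw [mem_inter_iff, hS, hT]
  constructor
  · rintro ⟨⟨p, hp, hy⟩, q, hq, hy'⟩
    obtain ⟨r, hr1, hr2⟩ := exists_pairCode (max (ratOfCode p.1) (ratOfCode q.1))
      (min (ratOfCode p.2) (ratOfCode q.2))
    refine ⟨r, ⟨(p, q), ⟨hp, hq⟩, by simp [hr1, hr2]⟩, ?_⟩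
    rw [mem_ratIoo] at hy hy' ⊢
    rw [hr1, hr2]
    push_cast
    exact ⟨max_lt hy.1 hy'.1, lt_min hy.2 hy'.2⟩
  · rintro ⟨r, ⟨⟨p, q⟩, ⟨hp, hq⟩, ⟨h1, h2⟩, h3, h4⟩, hy⟩
    rw [mem_ratIoo] at hy
    exact ⟨⟨p, hp, (Rat.cast_le.2 h1).trans_lt hy.1, hy.2.trans_le (Rat.cast_le.2 h3)⟩,
      q, hq, (Rat.cast_le.2 h2).trans_lt hy.1, hy.2.trans_le (Rat.cast_le.2 h4)⟩

theorem iUnion {S : α × β → Set ℝ} (hS : UniformlySigma S) :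
    UniformlySigma fun a => ⋃ b, S (a, b) := by
  obtain ⟨R, hR, hS⟩ := hS
  have hR' : REPred fun x : (α × PairCode) × β => R ((x.1.1, x.2), x.1.2) :=
    hR.comp (((Primrec.fst.comp Primrec.fst).pair Primrec.snd).pair
      (Primrec.snd.comp Primrec.fst)).to_comp
  refine ⟨_, hR'.exists, fun a y => ?_⟩
  simp only [mem_iUnion, hS]
  constructor
  · rintro ⟨b, p, hp, hy⟩
    exact ⟨p, ⟨b, hp⟩, hy⟩
  · rintro ⟨p, ⟨b, hp⟩, hy⟩
    exact ⟨b, p, hp, hy⟩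

theorem ratIoo {g : α → PairCode} (hg : Primrec g) : UniformlySigma fun a => ratIoo (g a) :=
  ⟨fun x => x.2 = g x.1, (Primrec.eq.comp Primrec.snd (hg.comp Primrec.fst)).rePred,
    fun a y => by simp⟩

theorem setOf_const {P : α → Prop} (hP : REPred P) : UniformlySigma fun a => {_y : ℝ | P a} := by
  refine ⟨fun x => P x.1, hP.comp Computable.fst, fun a y => ?_⟩
  refine ⟨fun h => ?_, fun ⟨_, h, _⟩ => h⟩
  obtain ⟨q, hq⟩ := exists_rat_lt y
  obtain ⟨r, hr⟩ := exists_rat_gt y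
  obtain ⟨p, hp1, hp2⟩ := exists_pairCode q r
  exact ⟨p, h, by rw [mem_ratIoo, hp1, hp2]; exact ⟨hq, hr⟩⟩

theorem shift {S : α → Set ℝ} {h : α → ℚ} (hS : UniformlySigma S) (hh : PrimrecRat h) :
    UniformlySigma fun a => {y : ℝ | y + (h a : ℝ) ∈ S a} := by
  obtain ⟨R, hR, hS⟩ := hS
  have hR' : REPred fun x : (α × PairCode) × PairCode => R (x.1.1, x.2) :=
    hR.comp ((Primrec.fst.comp Primrec.fst).pair Primrec.snd).to_comp
  have r1 : PrimrecRat fun x : (α × PairCode) × PairCode => ratOfCode x.1.2.1 :=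
    primrecRat_ratOfCode.comp (Primrec.fst.comp (Primrec.snd.comp Primrec.fst))
  have r2 : PrimrecRat fun x : (α × PairCode) × PairCode => ratOfCode x.1.2.2 :=
    primrecRat_ratOfCode.comp (Primrec.snd.comp (Primrec.snd.comp Primrec.fst))
  have s1 : PrimrecRat fun x : (α × PairCode) × PairCode => ratOfCode x.2.1 :=
    primrecRat_ratOfCode.comp (Primrec.fst.comp Primrec.snd)
  have s2 : PrimrecRat fun x : (α × PairCode) × PairCode => ratOfCode x.2.2 :=
    primrecRat_ratOfCode.comp (Primrec.snd.comp Primrec.snd)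
  have hh' : PrimrecRat fun x : (α × PairCode) × PairCode => h x.1.1 :=
    hh.comp (Primrec.fst.comp Primrec.fst)
  refine ⟨_, (hR'.and ((r1.eq (s1.sub hh')).and (r2.eq (s2.sub hh'))).rePred).exists,
    fun a y => ?_⟩
  rw [mem_ofPred_eq, hS]
  constructor
  · rintro ⟨p, hp, hy⟩
    obtain ⟨r, hr1, hr2⟩ := exists_pairCode (ratOfCode p.1 - h a) (ratOfCode p.2 - h a)
    refine ⟨r, ⟨p, hp, hr1, hr2⟩, ?_⟩
    rw [mem_ratIoo] at hy ⊢
    rw [hr1, hr2]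
    push_cast
    constructor <;> linarith [hy.1, hy.2]
  · rintro ⟨r, ⟨p, hp, hr1, hr2⟩, hy⟩
    refine ⟨p, hp, ?_⟩
    rw [mem_ratIoo] at hy ⊢
    rw [hr1, hr2] at hy
    push_cast at hy
    constructor <;> linarith [hy.1, hy.2]

theorem isSigma01 {S : α → Set ℝ} (hS : UniformlySigma S) (a : α) :
    IsSigma01 {y : unitInterval | (y : ℝ) ∈ S a} := by
  obtain ⟨R, hR, hS⟩ := hS
  obtain ⟨g, -, hg⟩ := exists_computable_ceSet hR
  refine ⟨g a, ?_⟩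
  ext y
  simp [sigmaClass, hg, hS]

theorem isComputable {f : unitInterval → ℝ} {S : PairCode → Set ℝ} (hS : UniformlySigma S)
    (h : ∀ (p : PairCode) (y : unitInterval), f y ∈ EffReal.ratIoo p ↔ (y : ℝ) ∈ S p) :
    IsComputable f := by
  obtain ⟨R, hR, hS⟩ := hS
  obtain ⟨g, hg', hg⟩ := exists_computable_ceSet hR
  refine ⟨g, hg', fun p => ?_⟩
  ext y
  simp [sigmaClass, hg, h, hS]

end UniformlySigma

/-- Restriction to `(0, 1)` turns a relatively open subset of `[0,1]` into an open subset of the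
line, which can then be translated. -/
theorem uniformlySigma_preimage {f : unitInterval → ℝ} (hf : IsComputable f) :
    UniformlySigma fun p : PairCode =>
      {y : ℝ | y ∈ Ioo (0 : ℝ) 1 ∧ IccExtend (zero_le_one' ℝ) f y ∈ ratIoo p} := by
  obtain ⟨g, hg, h⟩ := hf
  have h1 : UniformlySigma fun p : PairCode => {y : ℝ | ∃ q ∈ ceSet (g p), y ∈ ratIoo q} :=
    ⟨fun x => x.2 ∈ ceSet (g x.1),
      rePred_mem_ceSet.comp ((hg.comp Computable.fst).pair Computable.snd), fun a y => Iff.rfl⟩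
  obtain ⟨u, hu1, hu2⟩ := exists_pairCode 0 1
  refine ((UniformlySigma.ratIoo (Primrec.const u)).inter h1).of_eq fun p y => ?_
  have hu : ratIoo u = Ioo (0 : ℝ) 1 := by simp [ratIoo, hu1, hu2]
  simp only [mem_inter_iff, hu, mem_ofPred_eq]
  refine and_congr_right fun hy => ?_
  have hy' : y ∈ Icc (0 : ℝ) 1 := Ioo_subset_Icc_self hy
  rw [IccExtend_of_mem _ _ hy']
  have h2 := Set.ext_iff.1 (h p) ⟨y, hy'⟩
  exact h2.symm

theorem uniformlySigma_lt {f : unitInterval → ℝ} (hf : IsComputable f) :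
    UniformlySigma fun q : ℕ × ℕ × ℕ =>
      {y : ℝ | y ∈ Ioo (0 : ℝ) 1 ∧ (ratOfCode q : ℝ) < IccExtend (zero_le_one' ℝ) f y} := by
  refine ((uniformlySigma_preimage hf).comp
    (Computable.id (α := (ℕ × ℕ × ℕ) × (ℕ × ℕ × ℕ)))).iUnion.of_eq fun q y => ?_
  simp only [mem_iUnion, mem_ofPred_eq, id, mem_ratIoo]
  constructor
  · rintro ⟨r, hy, h1, h2⟩
    exact ⟨hy, h1⟩
  · rintro ⟨hy, h1⟩
    obtain ⟨r, hr⟩ := exists_rat_gt (IccExtend (zero_le_one' ℝ) f y)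
    obtain ⟨r, rfl⟩ := ratOfCode_surjective r
    exact ⟨r, hy, h1, hr⟩

theorem uniformlySigma_gt {f : unitInterval → ℝ} (hf : IsComputable f) :
    UniformlySigma fun q : ℕ × ℕ × ℕ =>
      {y : ℝ | y ∈ Ioo (0 : ℝ) 1 ∧ IccExtend (zero_le_one' ℝ) f y < (ratOfCode q : ℝ)} := by
  refine ((uniformlySigma_preimage hf).comp (f := fun x : (ℕ × ℕ × ℕ) × (ℕ × ℕ × ℕ) => (x.2, x.1))
    (Computable.snd.pair Computable.fst)).iUnion.of_eq fun q y => ?_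
  simp only [mem_iUnion, mem_ofPred_eq, mem_ratIoo]
  constructor
  · rintro ⟨r, hy, h1, h2⟩
    exact ⟨hy, h2⟩
  · rintro ⟨hy, h1⟩
    obtain ⟨r, hr⟩ := exists_rat_lt (IccExtend (zero_le_one' ℝ) f y)
    obtain ⟨r, rfl⟩ := ratOfCode_surjective r
    exact ⟨r, hy, hr, h1⟩

/-- The iterated forward differences of a computable function are uniformly computable. -/
theorem uniformlySigma_fwdDiff {f : unitInterval → ℝ} (hf : IsComputable f) (n : ℕ) :
    (UniformlySigma fun a : (ℕ × ℕ × ℕ) × (ℕ × ℕ × ℕ) =>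
      {y : ℝ | 0 < y ∧ y + n * (ratOfCode a.1 : ℝ) < 1 ∧ 0 < ratOfCode a.1 ∧ (ratOfCode a.2 : ℝ) <
        (fwdDiff (ratOfCode a.1 : ℝ))^[n] (IccExtend (zero_le_one' ℝ) f) y}) ∧
    (UniformlySigma fun a : (ℕ × ℕ × ℕ) × (ℕ × ℕ × ℕ) =>
      {y : ℝ | 0 < y ∧ y + n * (ratOfCode a.1 : ℝ) < 1 ∧ 0 < ratOfCode a.1 ∧
        (fwdDiff (ratOfCode a.1 : ℝ))^[n] (IccExtend (zero_le_one' ℝ) f) y <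
          (ratOfCode a.2 : ℝ)}) := by
  induction n with
  | zero =>
    have hpos : UniformlySigma fun a : (ℕ × ℕ × ℕ) × (ℕ × ℕ × ℕ) =>
        {_y : ℝ | 0 < ratOfCode a.1} :=
      UniformlySigma.setOf_const ((PrimrecRat.const 0).lt
        (primrecRat_ratOfCode.comp Primrec.fst)).rePred
    constructor
    · refine (((uniformlySigma_lt hf).comp
        (Computable.snd (α := ℕ × ℕ × ℕ))).inter hpos).of_eq fun a y => ?_
      simp only [mem_inter_iff, mem_ofPred_eq, mem_Ioo, Nat.cast_zero, zero_mul, add_zero,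
        Function.iterate_zero, id]
      tauto
    · refine (((uniformlySigma_gt hf).comp
        (Computable.snd (α := ℕ × ℕ × ℕ))).inter hpos).of_eq fun a y => ?_
      simp only [mem_inter_iff, mem_ofPred_eq, mem_Ioo, Nat.cast_zero, zero_mul, add_zero,
        Function.iterate_zero, id]
      tauto
  | succ n ih =>
    obtain ⟨hl, hg⟩ := ih
    have p11 : Primrec fun x : ((ℕ × ℕ × ℕ) × (ℕ × ℕ × ℕ)) × PairCode => x.1.1 :=
      Primrec.fst.comp Primrec.fst
    have p12 : Primrec fun x : ((ℕ × ℕ × ℕ) × (ℕ × ℕ × ℕ)) × PairCode => x.1.2 :=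
      Primrec.snd.comp Primrec.fst
    have p21 : Primrec fun x : ((ℕ × ℕ × ℕ) × (ℕ × ℕ × ℕ)) × PairCode => x.2.1 :=
      Primrec.fst.comp Primrec.snd
    have p22 : Primrec fun x : ((ℕ × ℕ × ℕ) × (ℕ × ℕ × ℕ)) × PairCode => x.2.2 :=
      Primrec.snd.comp Primrec.snd
    have r11 := primrecRat_ratOfCode.comp p11
    have r12 := primrecRat_ratOfCode.comp p12
    have r21 := primrecRat_ratOfCode.comp p21
    have r22 := primrecRat_ratOfCode.comp p22
    -- A difference `u - v` exceeds `q` iff there are rationals `s < u` and `t > v` with `q ≤ s -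
    -- t`. A lower bound thus uses an upper bound of the previous order, so both halves go through
    -- the induction together.
    constructor
    · have h1 := (hl.comp (p11.pair p21).to_comp).shift r11
      have h2 := hg.comp (p11.pair p22).to_comp
      have h3 := UniformlySigma.setOf_const (r12.le (r21.sub r22)).rePred
      refine ((h1.inter h2).inter h3).iUnion.of_eq fun a y => ?_
      obtain ⟨h, q⟩ := a
      simp only [mem_iUnion, mem_inter_iff, mem_ofPred_eq, Function.iterate_succ_apply', fwdDiff]
      constructor
      · rintro ⟨⟨s, t⟩, ⟨⟨-, h1, -, h2⟩, h3, -, h4, h5⟩, h6⟩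
        refine ⟨h3, by push_cast; linarith, h4, ?_⟩
        have : (ratOfCode q : ℝ) ≤ ratOfCode s - ratOfCode t := by exact_mod_cast h6
        linarith
      · rintro ⟨h1, h2, h3, h4⟩
        have h3' : (0 : ℝ) < ratOfCode h := by exact_mod_cast h3
        have h7 : (0 : ℝ) ≤ n * ratOfCode h := by positivity
        push_cast at h2
        obtain ⟨t, ht1, ht2⟩ := exists_rat_btwn (lt_sub_comm.1 h4)
        obtain ⟨t, rfl⟩ := ratOfCode_surjective t
        obtain ⟨s, hs⟩ := ratOfCode_surjective (ratOfCode t + ratOfCode q)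
        refine ⟨(s, t), ⟨⟨by linarith, by linarith, h3, ?_⟩, h1, by linarith, h3, ht1⟩, ?_⟩
        · rw [hs]; push_cast; linarith
        · simp [hs]
    · have h1 := (hg.comp (p11.pair p21).to_comp).shift r11
      have h2 := hl.comp (p11.pair p22).to_comp
      have h3 := UniformlySigma.setOf_const ((r21.sub r22).le r12).rePred
      refine ((h1.inter h2).inter h3).iUnion.of_eq fun a y => ?_
      obtain ⟨h, q⟩ := a
      simp only [mem_iUnion, mem_inter_iff, mem_ofPred_eq, Function.iterate_succ_apply', fwdDiff]
      constructor
      · rintro ⟨⟨s, t⟩, ⟨⟨-, h1, -, h2⟩, h3, -, h4, h5⟩, h6⟩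
        refine ⟨h3, by push_cast; linarith, h4, ?_⟩
        have : (ratOfCode s : ℝ) - ratOfCode t ≤ ratOfCode q := by exact_mod_cast h6
        linarith
      · rintro ⟨h1, h2, h3, h4⟩
        have h3' : (0 : ℝ) < ratOfCode h := by exact_mod_cast h3
        have h7 : (0 : ℝ) ≤ n * ratOfCode h := by positivity
        push_cast at h2
        obtain ⟨t, ht1, ht2⟩ := exists_rat_btwn (sub_lt_comm.1 h4)
        obtain ⟨t, rfl⟩ := ratOfCode_surjective t
        obtain ⟨s, hs⟩ := ratOfCode_surjective (ratOfCode t + ratOfCode q)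
        refine ⟨(s, t), ⟨⟨by linarith, by linarith, h3, ?_⟩, h1, by linarith, h3, ht2⟩, ?_⟩
        · rw [hs]; push_cast; linarith
        · simp [hs]

end UniformFamilies

/-! ### Iterated forward differences and derivatives -/

section ForwardDifferences

/-- Mean value theorem for iterated forward differences. -/
theorem exists_fwdDiff_iterate_eq {m : ℕ} {G : ℕ → ℝ → ℝ} {a b : ℝ}
    (hG : ∀ k < m, ∀ z ∈ Ioo a b, HasDerivAt (G k) (G (k + 1) z) z) {z h : ℝ} (hz : a < z)
    (hh : 0 < h) (hzb : z + m * h < b) :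
    ∃ ξ ∈ Icc z (z + m * h), (fwdDiff h)^[m] (G 0) z = h ^ m * G m ξ := by
  induction m generalizing G b with
  | zero => exact ⟨z, by simp, by simp⟩
  | succ m ih =>
    push_cast at hzb ⊢
    -- One difference is absorbed into the functions, at the cost of shortening the interval by `h`;
    -- the ordinary mean value theorem then resolves it.
    obtain ⟨ξ, hξ, h1⟩ := ih (G := fun k => fwdDiff h (G k)) (b := b - h) (fun k hk w hw => by
      have h2 := (hG k (by omega) (w + h) ⟨by linarith [hw.1], by linarith [hw.2]⟩).comp_add_const w h
      exact h2.sub (hG k (by omega) w ⟨hw.1, by linarith [hw.2]⟩)) (by linarith)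
    have hsub : Icc ξ (ξ + h) ⊆ Ioo a b := fun w hw =>
      ⟨by linarith [hw.1, hξ.1], by linarith [hw.2, hξ.2]⟩
    obtain ⟨η, hη, h2⟩ := exists_hasDerivAt_eq_slope (G m) (G (m + 1)) (lt_add_of_pos_right ξ hh)
      (fun w hw => (hG m (by omega) w (hsub hw)).continuousAt.continuousWithinAt)
      (fun w hw => hG m (by omega) w (hsub (Ioo_subset_Icc_self hw)))
    refine ⟨η, ⟨by linarith [hξ.1, hη.1], by linarith [hξ.2, hη.2]⟩, ?_⟩
    rw [Function.iterate_succ_apply]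
    refine h1.trans ?_
    rw [h2, fwdDiff, add_sub_cancel_left, pow_succ, mul_assoc, mul_div_cancel₀ _ hh.ne']

/-- The `(m + 1)`-st difference quotients converge to the `(m + 1)`-st derivative, which need not be
continuous. -/
theorem exists_forall_abs_fwdDiff_iterate_sub_le {m : ℕ} {G : ℕ → ℝ → ℝ} {a b y D ε : ℝ}
    (hG : ∀ k < m, ∀ z ∈ Ioo a b, HasDerivAt (G k) (G (k + 1) z) z) (hy : y ∈ Ioo a b)
    (hD : HasDerivAt (G m) D y) (hε : 0 < ε) :
    ∃ δ > 0, ∀ h, 0 < h → h < δ → y + (m + 1) * h < b →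
      |(fwdDiff h)^[m + 1] (G 0) y - h ^ (m + 1) * D| ≤ ε * h ^ (m + 1) := by
  -- The points `ξ + h` and `ξ` used below are within `(m + 1) h` and `m h` of `y`, so the two
  -- errors add up to a multiple `2 m + 1` of `h`.
  have hc : 0 < ε / (2 * m + 1) := by positivity
  have h1 := (hasDerivAt_iff_isLittleO.1 hD).def hc
  obtain ⟨δ, hδ, h2⟩ := Metric.eventually_nhds_iff.1 h1
  refine ⟨δ / (m + 1), by positivity, fun h hh hhδ hyb => ?_⟩
  have hhδ' : (m + 1) * h < δ := by
    rw [lt_div_iff₀ (by positivity)] at hhδ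
    linarith
  -- The mean value theorem removes only `m` of the `m + 1` differences. The remaining one is
  -- estimated by differentiability of `G m` at the single point `y`, so no continuity of the last
  -- derivative is required.
  obtain ⟨ξ, hξ, h3⟩ := exists_fwdDiff_iterate_eq (G := fun k => fwdDiff h (G k)) (a := a)
    (b := b - h) (m := m) (z := y) (h := h) (fun k hk w hw => by
      have h2 := (hG k (by omega) (w + h) ⟨by linarith [hw.1], by linarith [hw.2]⟩).comp_add_const w h
      exact h2.sub (hG k (by omega) w ⟨hw.1, by linarith [hw.2]⟩)) hy.1 hh (by linarith)
  have h0 : (0 : ℝ) ≤ m * h := by positivity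
  have e1 := h2 (y := ξ + h) (by
    rw [Real.dist_eq, abs_lt]; constructor <;> linarith [hξ.1, hξ.2])
  have e2 := h2 (y := ξ) (by
    rw [Real.dist_eq, abs_lt]; constructor <;> linarith [hξ.1, hξ.2])
  simp only [Real.norm_eq_abs, smul_eq_mul] at e1 e2
  have e1' : |ξ + h - y| ≤ (m + 1) * h := by
    rw [abs_le]; constructor <;> linarith [hξ.1, hξ.2]
  have e2' : |ξ - y| ≤ m * h := by
    rw [abs_le]; constructor <;> linarith [hξ.1, hξ.2]
  have e3 : |G m (ξ + h) - G m ξ - h * D| ≤ ε * h := by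
    have e4 : G m (ξ + h) - G m ξ - h * D = (G m (ξ + h) - G m y - (ξ + h - y) * D) -
        (G m ξ - G m y - (ξ - y) * D) := by ring
    rw [e4]
    refine (abs_sub _ _).trans ((add_le_add e1 e2).trans ?_)
    calc ε / (2 * m + 1) * |ξ + h - y| + ε / (2 * m + 1) * |ξ - y|
        ≤ ε / (2 * m + 1) * ((m + 1) * h) + ε / (2 * m + 1) * (m * h) := by gcongr
      _ = ε * h := by field_simp; ring
  rw [Function.iterate_succ_apply]
  have e5 : (fwdDiff h)^[m] (fwdDiff h (G 0)) y - h ^ (m + 1) * D =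
      h ^ m * (G m (ξ + h) - G m ξ - h * D) := by
    rw [h3, fwdDiff]; ring
  rw [e5, abs_mul, abs_of_nonneg (by positivity), pow_succ]
  calc h ^ m * |G m (ξ + h) - G m ξ - h * D| ≤ h ^ m * (ε * h) := by gcongr
    _ = ε * (h ^ m * h) := by ring

end ForwardDifferences

/-! ### Continuity of the derivative at generic points -/

section GenericPoints

theorem NTimesDifferentiable.hasDerivAt {n k : ℕ} {f : unitInterval → ℝ}
    (hf : NTimesDifferentiable n f) (hk : k < n) {y : ℝ} (hy : y ∈ Ioo (0 : ℝ) 1) :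
    HasDerivAt (iteratedDerivWithin k (IccExtend (zero_le_one' ℝ) f) (Icc 0 1))
      (iteratedDerivWithin (k + 1) (IccExtend (zero_le_one' ℝ) f) (Icc 0 1) y) y := by
  have h1 := (hf k hk y (Ioo_subset_Icc_self hy)).hasDerivWithinAt
  rw [← iteratedDerivWithin_succ] at h1
  exact h1.hasDerivAt (Icc_mem_nhds hy.1 hy.2)

/-- The singletons of the endpoints are `Π⁰₁` classes with empty interior. Hence only interior
points matter below, where forward differences fit inside the interval. -/
theorem IsOneGeneric.mem_Ioo {x : unitInterval} (hx : IsOneGeneric x) :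
    (x : ℝ) ∈ Ioo (0 : ℝ) 1 := by
  have key : ∀ t : unitInterval, IsSigma01 {t}ᶜ → x ≠ t := by
    rintro t ht rfl
    refine hx {x} ht ⟨rfl, ?_⟩
    rw [interior_singleton]
    exact notMem_empty x
  have hσ : ∀ t : unitInterval, ∀ a b : ℚ, (∀ y : unitInterval, y ≠ t ↔ (a : ℝ) < y ∧ (y : ℝ) < b) →
      IsSigma01 {t}ᶜ := by
    intro t a b h
    obtain ⟨p, hp1, hp2⟩ := exists_pairCode a b
    have h1 := (UniformlySigma.ratIoo (Primrec.const p : Primrec fun _ : ℕ => p)).isSigma01 0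
    convert h1 using 1
    ext y
    simp [mem_ratIoo, hp1, hp2, h]
  have h0 : x ≠ 0 := key 0 <| hσ 0 0 2 fun y => by
    have h1 := y.2.2
    have h2 := y.2.1
    rw [Ne, Subtype.ext_iff, Icc.coe_zero]
    push_cast
    exact ⟨fun h => ⟨lt_of_le_of_ne h2 (Ne.symm h), by linarith⟩, fun h => h.1.ne'⟩
  have h1 : x ≠ 1 := key 1 <| hσ 1 (-1) 1 fun y => by
    have h1 := y.2.2
    have h2 := y.2.1
    rw [Ne, Subtype.ext_iff, Icc.coe_one]
    push_cast
    exact ⟨fun h => ⟨by linarith, lt_of_le_of_ne h1 h⟩, fun h => h.2.ne⟩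
  exact ⟨unitInterval.pos_iff_ne_zero.2 h0, unitInterval.lt_one_iff_ne_one.2 h1⟩

theorem IsOneGeneric.eventually_nthDeriv_lt {x : unitInterval} (hx : IsOneGeneric x) {m : ℕ}
    {f : unitInterval → ℝ} (hf : IsComputable f) (hd : NTimesDifferentiable (m + 1) f) {r : ℝ}
    (hr : nthDeriv (m + 1) f x < r) : ∀ᶠ y in nhds x, nthDeriv (m + 1) f y < r := by
  have hx01 := hx.mem_Ioo
  set F := IccExtend (zero_le_one' ℝ) f with hF
  obtain ⟨q, hq1, hq2⟩ := exists_rat_btwn hr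
  have hlim : ∀ y ∈ Ioo (0 : ℝ) 1, ∀ ε > 0, ∃ δ > 0, ∀ h, 0 < h → h < δ → y + (m + 1) * h < 1 →
      |(fwdDiff h)^[m + 1] F y - h ^ (m + 1) * iteratedDerivWithin (m + 1) F (Icc 0 1) y| ≤
        ε * h ^ (m + 1) := by
    intro y hy ε hε
    have h1 := exists_forall_abs_fwdDiff_iterate_sub_le
      (G := fun k => iteratedDerivWithin k F (Icc 0 1)) (m := m)
      (fun k hk z hz => hd.hasDerivAt (by omega) hz) hy (hd.hasDerivAt (by omega) hy) hε
    simpa only [iteratedDerivWithin_zero] using h1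
  -- This error bound says that at `x` every difference with `h < δ` is at most `q h^(m+1)`, which
  -- keeps `x` out of the open set below.
  obtain ⟨δ, hδ, h1⟩ := hlim x hx01 (q - nthDeriv (m + 1) f x) (by linarith)
  obtain ⟨d, hd0, hdδ⟩ := exists_rat_btwn (lt_min hδ (one_pos : (0 : ℝ) < 1))
  have hS : UniformlySigma fun _ : ℕ => {y : ℝ | ∃ h : ℕ × ℕ × ℕ, 0 < y ∧
      y + (m + 1 : ℕ) * (ratOfCode h : ℝ) < 1 ∧ 0 < ratOfCode h ∧ ratOfCode h < d ∧
      q * (ratOfCode h : ℝ) ^ (m + 1) < (fwdDiff (ratOfCode h : ℝ))^[m + 1] F y} := by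
    obtain ⟨g, hg, hg'⟩ := ((PrimrecRat.const q).mul
      ((primrecRat_ratOfCode.comp (Primrec.snd (α := ℕ))).pow (m + 1)))
    have h2 := (uniformlySigma_fwdDiff hf (m + 1)).1.comp (Primrec.snd.pair hg).to_comp
    have h3 := UniformlySigma.setOf_const ((primrecRat_ratOfCode.comp (Primrec.snd (α := ℕ))).lt
      (PrimrecRat.const d)).rePred
    refine (h2.inter h3).iUnion.of_eq fun a y => ?_
    simp only [mem_iUnion, mem_inter_iff, mem_ofPred_eq, hg']
    push_cast
    exact exists_congr fun h => by tauto
  have hnot := hx _ (by rw [IsPi01, compl_compl]; exact hS.isSigma01 0)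
  rw [mem_sdiff, not_and_not_right] at hnot
  have hmem : x ∈ interior _ := hnot (by
    rintro ⟨h, -, h3, h4, h5, h6⟩
    have h4' : (0 : ℝ) < ratOfCode h := by exact_mod_cast h4
    have h5' : (ratOfCode h : ℝ) < d := by exact_mod_cast h5
    have h7 := h1 (ratOfCode h) h4' (h5'.trans (hdδ.trans_le (min_le_left _ _)))
      (by push_cast at h3; exact h3)
    have h8 := (abs_le.1 h7).2
    have h9 : nthDeriv (m + 1) f x = iteratedDerivWithin (m + 1) F (Icc 0 1) x := rfl
    rw [h9] at h8
    linarith)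
  rw [mem_interior_iff_mem_nhds] at hmem
  have hnhds : ∀ᶠ y : unitInterval in nhds x, (y : ℝ) ∈ Ioo (0 : ℝ) 1 :=
    continuous_subtype_val.continuousAt.eventually (Ioo_mem_nhds hx01.1 hx01.2)
  filter_upwards [hmem, hnhds] with y hyV hy
  refine lt_of_le_of_lt ?_ hq2
  by_contra! hcon
  have h9 : nthDeriv (m + 1) f y = iteratedDerivWithin (m + 1) F (Icc 0 1) y := rfl
  set D := nthDeriv (m + 1) f y with hD
  -- Half the excess leaves quotients at least `(D + q) / 2 > q`, so a small rational `h` puts `y`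
  -- into the open set.
  obtain ⟨δ', hδ', h2⟩ := hlim y hy ((D - q) / 2) (by linarith)
  rw [← h9] at h2
  have hpos : 0 < min (min δ' d) ((1 - (y : ℝ)) / (m + 1)) :=
    lt_min (lt_min hδ' hd0) (div_pos (by linarith [hy.2]) (by positivity))
  obtain ⟨h, hh0, hh⟩ := exists_rat_btwn hpos
  obtain ⟨h, rfl⟩ := ratOfCode_surjective h
  rw [lt_min_iff, lt_min_iff, lt_div_iff₀ (by positivity)] at hh
  refine hyV ⟨h, hy.1, by push_cast; linarith [hh.2], by exact_mod_cast hh0,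
    by exact_mod_cast hh.1.2, ?_⟩
  have h3 := (abs_le.1 (h2 _ hh0 hh.1.1 (by linarith [hh.2]))).1
  have h4 : (0 : ℝ) < (ratOfCode h : ℝ) ^ (m + 1) := by positivity
  nlinarith

theorem IsComputable.neg {f : unitInterval → ℝ} (hf : IsComputable f) : IsComputable (-f) := by
  obtain ⟨g, hg, h⟩ := hf
  obtain ⟨N, hN, hN'⟩ := primrecRat_ratOfCode.neg
  refine ⟨fun p => g (N p.2, N p.1), hg.comp
    ((hN.comp Primrec.snd).pair (hN.comp Primrec.fst)).to_comp, fun p => ?_⟩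
  rw [← h]
  ext y
  simp only [mem_preimage, mem_ratIoo, hN', Pi.neg_apply]
  push_cast
  constructor <;> rintro ⟨h1, h2⟩ <;> constructor <;> linarith

theorem iccExtend_neg (f : unitInterval → ℝ) :
    IccExtend (zero_le_one' ℝ) (-f) = -IccExtend (zero_le_one' ℝ) f := rfl

theorem iteratedDerivWithin_iccExtend_neg (k : ℕ) (f : unitInterval → ℝ) :
    iteratedDerivWithin k (IccExtend (zero_le_one' ℝ) (-f)) (Icc 0 1) =
      -iteratedDerivWithin k (IccExtend (zero_le_one' ℝ) f) (Icc 0 1) := by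
  ext y
  rw [iccExtend_neg, iteratedDerivWithin_neg]
  rfl

theorem NTimesDifferentiable.neg {n : ℕ} {f : unitInterval → ℝ} (hf : NTimesDifferentiable n f) :
    NTimesDifferentiable n (-f) := fun k hk => by
  rw [iteratedDerivWithin_iccExtend_neg]
  exact (hf k hk).neg

theorem nthDeriv_neg (n : ℕ) (f : unitInterval → ℝ) (y : unitInterval) :
    nthDeriv n (-f) y = -nthDeriv n f y := by
  rw [nthDeriv, iteratedDerivWithin_iccExtend_neg]
  rfl

theorem IsOneGeneric.continuousAt_nthDeriv {x : unitInterval} (hx : IsOneGeneric x) {n : ℕ}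
    (hn : 1 ≤ n) {f : unitInterval → ℝ} (hf : IsComputable f) (hd : NTimesDifferentiable n f) :
    ContinuousAt (nthDeriv n f) x := by
  obtain ⟨m, rfl⟩ := Nat.exists_eq_add_of_le' hn
  refine tendsto_order.2 ⟨fun r hr => ?_, fun r hr => hx.eventually_nthDeriv_lt hf hd hr⟩
  have h1 := hx.eventually_nthDeriv_lt hf.neg hd.neg (r := -r) (by rw [nthDeriv_neg]; linarith)
  filter_upwards [h1] with y hy
  rw [nthDeriv_neg] at hy
  linarith

end GenericPoints

/-! ### The polynomial bump and its derivatives -/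

section PolynomialBump

open Polynomial

/-- The polynomial `(X (1 - X)) ^ (n + 1)`. -/
noncomputable def bumpPoly (n : ℕ) : ℝ[X] := (X * (1 - X)) ^ (n + 1)

open Classical in
/-- The `k`-th derivative of the bump function `(t (1 - t)) ^ (n + 1)` on `[0,1]`, extended by `0`
to the real line. -/
noncomputable def bumpDeriv (n k : ℕ) (t : ℝ) : ℝ :=
  if t ∈ Ioo (0 : ℝ) 1 then (derivative^[k] (bumpPoly n)).eval t else 0

/-- The roots `0` and `1` have multiplicity `n + 1`, and `k` derivatives lower it by at most `k`. -/
theorem eval_iterate_derivative_bumpPoly {n k : ℕ} (hk : k ≤ n) {t : ℝ} (ht : t * (1 - t) = 0) :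
    (derivative^[k] (bumpPoly n)).eval t = 0 := by
  have h1 : (X * (1 - X) : ℝ[X]) ^ (n + 1 - k) ∣ derivative^[k] (bumpPoly n) :=
    pow_sub_dvd_iterate_derivative_of_pow_dvd k dvd_rfl
  obtain ⟨q, hq⟩ := h1
  rw [hq]
  simp [ht, show n + 1 - k ≠ 0 by omega]

theorem abs_bumpDeriv_le_eval (n k : ℕ) (t : ℝ) :
    |bumpDeriv n k t| ≤ |(derivative^[k] (bumpPoly n)).eval t| := by
  rw [bumpDeriv]
  split_ifs <;> simp

/-- At the gluing points `0` and `1` the polynomial derivatives of orders `k` and `k + 1` both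
vanish. Truncation does not increase absolute values, so the little-o estimate for the polynomial
carries over. -/
theorem hasDerivAt_bumpDeriv {n k : ℕ} (hk : k < n) (t : ℝ) :
    HasDerivAt (bumpDeriv n k) (bumpDeriv n (k + 1) t) t := by
  have hP : HasDerivAt (fun t => (derivative^[k] (bumpPoly n)).eval t)
      ((derivative^[k + 1] (bumpPoly n)).eval t) t := by
    rw [Function.iterate_succ_apply']
    exact Polynomial.hasDerivAt _ t
  by_cases h1 : t ∈ Ioo (0 : ℝ) 1
  · have h2 : bumpDeriv n (k + 1) t = (derivative^[k + 1] (bumpPoly n)).eval t := if_pos h1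
    rw [h2]
    refine hP.congr_of_eventuallyEq ?_
    filter_upwards [isOpen_Ioo.mem_nhds h1] with s hs
    exact if_pos hs
  · have h2 : bumpDeriv n (k + 1) t = 0 := if_neg h1
    rw [h2]
    by_cases h3 : t ∈ Icc (0 : ℝ) 1
    · have h4 : t * (1 - t) = 0 := by
        by_contra h5
        rw [mul_eq_zero, not_or] at h5
        exact h1 ⟨lt_of_le_of_ne h3.1 (Ne.symm h5.1),
          lt_of_le_of_ne h3.2 fun h => h5.2 (by rw [h, sub_self])⟩
      have h6 := eval_iterate_derivative_bumpPoly (n := n) (k := k) (by omega) h4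
      rw [eval_iterate_derivative_bumpPoly (by omega) h4, hasDerivAt_iff_isLittleO] at hP
      rw [hasDerivAt_iff_isLittleO]
      have h7 : bumpDeriv n k t = 0 := if_neg h1
      simp only [h6, h7, sub_zero, smul_zero] at hP ⊢
      exact (Asymptotics.isBigO_of_le _ fun s => abs_bumpDeriv_le_eval n k s).trans_isLittleO hP
    · refine (hasDerivAt_const t (0 : ℝ)).congr_of_eventuallyEq ?_
      filter_upwards [isClosed_Icc.isOpen_compl.mem_nhds h3] with s hs
      exact if_neg fun h => hs (Ioo_subset_Icc_self h)

theorem exists_forall_abs_bumpDeriv_le (n : ℕ) :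
    ∃ C : ℝ, 0 < C ∧ ∀ k ≤ n, ∀ t, |bumpDeriv n k t| ≤ C := by
  have h1 : ∀ k, ∃ C : ℝ, ∀ t, |bumpDeriv n k t| ≤ C := by
    intro k
    obtain ⟨C, hC⟩ := (isCompact_Icc (a := (0 : ℝ)) (b := 1)).exists_bound_of_continuousOn
      (derivative^[k] (bumpPoly n)).continuous.continuousOn
    refine ⟨C, fun t => ?_⟩
    by_cases ht : t ∈ Ioo (0 : ℝ) 1
    · exact (abs_bumpDeriv_le_eval n k t).trans (hC t (Ioo_subset_Icc_self ht))
    · rw [bumpDeriv, if_neg ht, abs_zero]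
      exact (norm_nonneg _).trans (hC 0 (by simp))
  choose C hC using h1
  have hC0 : ∀ k, 0 ≤ C k := fun k => (abs_nonneg _).trans (hC k 0)
  refine ⟨∑ k ∈ Finset.range (n + 1), C k + 1,
    add_pos_of_nonneg_of_pos (Finset.sum_nonneg fun k _ => hC0 k) one_pos, fun k hk t => ?_⟩
  have h2 := Finset.single_le_sum (f := C) (fun k _ => hC0 k)
    (Finset.mem_range.2 (Nat.lt_succ_of_le hk))
  linarith [hC k t]

theorem natDegree_bumpPoly (n : ℕ) : (bumpPoly n).natDegree = 2 * (n + 1) := by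
  have h1 : (X * (1 - X) : ℝ[X]).natDegree = 2 := by compute_degree!
  rw [bumpPoly, natDegree_pow, h1, mul_comm]

/-- The polynomial has degree `2 n + 2`, so coefficient `n + 2` of its `n`-th derivative is a
nonzero multiple of the leading coefficient; a nonzero polynomial cannot vanish on an interval. -/
theorem exists_bumpDeriv_ne_zero (n : ℕ) : ∃ t ∈ Ioo (0 : ℝ) 1, bumpDeriv n n t ≠ 0 := by
  have h1 : derivative^[n] (bumpPoly n) ≠ 0 := by
    intro h
    have h2 := congrArg (fun p => p.coeff (n + 2)) h
    simp only [coeff_iterate_derivative, coeff_zero, smul_eq_zero] at h2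
    rcases h2 with h2 | h2
    · exact absurd (Nat.descFactorial_eq_zero_iff_lt.1 h2) (by omega)
    · have h3 : n + 2 + n = (bumpPoly n).natDegree := by rw [natDegree_bumpPoly]; ring
      rw [h3, coeff_natDegree, leadingCoeff_eq_zero] at h2
      have h4 := natDegree_bumpPoly n
      rw [h2, natDegree_zero] at h4
      omega
  by_contra! hcon
  refine h1 (Polynomial.eq_zero_of_infinite_isRoot _
    ((Ioo_infinite (zero_lt_one' ℝ)).mono fun t ht => ?_))
  have h2 := hcon t ht
  rwa [bumpDeriv, if_pos ht] at h2

/-- This form uses only operations available for names of rationals. -/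
theorem bumpDeriv_zero_eq (n : ℕ) (t : ℝ) :
    bumpDeriv n 0 t = max 0 (t * (1 - t)) ^ (n + 1) := by
  rw [bumpDeriv]
  split_ifs with h
  · rw [max_eq_right (mul_nonneg h.1.le (by linarith [h.2]))]
    simp [bumpPoly]
  · rw [max_eq_left, zero_pow n.succ_ne_zero]
    by_contra! h1
    refine h ?_
    rcases pos_and_pos_or_neg_and_neg_of_mul_pos h1 with ⟨h2, h3⟩ | ⟨h2, h3⟩
    · exact ⟨h2, by linarith⟩
    · linarith

end PolynomialBump

/-! ### Effective decomposition of an open set into dyadic cells -/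

section DyadicCells

/-- The effectively open subset of the real line with index `e`. -/
def sigmaSet (e : Nat.Partrec.Code) : Set ℝ := {y | ∃ p ∈ ceSet e, y ∈ ratIoo p}

/-- The half-open dyadic interval `[j / 2 ^ s, (j + 1) / 2 ^ s)` for `i = (s, j)`. -/
def cell (i : ℕ × ℕ) : Set ℝ := Ico ((i.2 : ℝ) / 2 ^ i.1) (((i.2 : ℝ) + 1) / 2 ^ i.1)

/-- The dyadic interval `i = (s, j)` is seen at stage `s` to be contained in one of the intervals
that make up the effectively open set with index `e`. -/
def Covered (e : Nat.Partrec.Code) (i : ℕ × ℕ) : Prop :=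
  ∃ m < i.1, (Nat.Partrec.Code.evaln i.1 e m).isSome = true ∧
    ratOfCode (Denumerable.ofNat PairCode m).1 < (i.2 : ℚ) * (1 / 2 ^ i.1) ∧
    ((i.2 + 1 : ℕ) : ℚ) * (1 / 2 ^ i.1) < ratOfCode (Denumerable.ofNat PairCode m).2

/-- The dyadic intervals in `[0,1]` that are covered but whose parent is not. -/
def Selected (e : Nat.Partrec.Code) (i : ℕ × ℕ) : Prop :=
  i.2 < 2 ^ i.1 ∧ Covered e i ∧ ¬ (0 < i.1 ∧ Covered e (i.1 - 1, i.2 / 2))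

theorem mem_cell_iff {s j : ℕ} {y : ℝ} : y ∈ cell (s, j) ↔ 0 ≤ y ∧ ⌊y * 2 ^ s⌋₊ = j := by
  have h2 : (0 : ℝ) < 2 ^ s := by positivity
  simp only [cell, mem_Ico, div_le_iff₀ h2, lt_div_iff₀ h2]
  constructor
  · rintro ⟨h3, h4⟩
    have h5 : 0 ≤ y * 2 ^ s := (Nat.cast_nonneg j).trans h3
    exact ⟨nonneg_of_mul_nonneg_left h5 h2, (Nat.floor_eq_iff h5).2 ⟨h3, h4⟩⟩
  · rintro ⟨h3, h4⟩
    exact (Nat.floor_eq_iff (by positivity)).1 h4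

theorem mem_cell_floor (s : ℕ) {y : ℝ} (hy : 0 ≤ y) : y ∈ cell (s, ⌊y * 2 ^ s⌋₊) :=
  mem_cell_iff.2 ⟨hy, rfl⟩

/-- Dividing the index of a cell by `2 ^ d` gives its ancestor `d` levels up. -/
theorem floor_mul_two_pow_add_div (y : ℝ) (s d : ℕ) :
    ⌊y * 2 ^ (s + d)⌋₊ / 2 ^ d = ⌊y * 2 ^ s⌋₊ := by
  have h1 := Nat.floor_div_natCast (y * 2 ^ (s + d)) (2 ^ d)
  rw [← h1]
  congr 1
  push_cast
  rw [pow_add]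
  field_simp

namespace Covered

variable {e : Nat.Partrec.Code}

theorem closure_cell_subset {i : ℕ × ℕ} (h : Covered e i) :
    Icc ((i.2 : ℝ) / 2 ^ i.1) (((i.2 : ℝ) + 1) / 2 ^ i.1) ⊆ sigmaSet e := by
  obtain ⟨m, -, h1, h2, h3⟩ := h
  intro y hy
  refine ⟨Denumerable.ofNat PairCode m, ?_, ?_, ?_⟩
  · obtain ⟨x, hx⟩ := Option.isSome_iff_exists.1 h1
    have h4 := Nat.Partrec.Code.evaln_sound hx
    rw [ceSet, mem_ofPred_eq, Denumerable.encode_ofNat]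
    exact Part.dom_iff_mem.2 ⟨_, h4⟩
  · have h4 := (Rat.cast_lt (K := ℝ)).2 h2
    push_cast at h4
    rw [mul_one_div] at h4
    exact h4.trans_le hy.1
  · have h4 := (Rat.cast_lt (K := ℝ)).2 h3
    push_cast at h4
    rw [mul_one_div] at h4
    exact hy.2.trans_lt h4

/-- Subdividing shrinks the cell and raises the stage bound, and both favour being covered. -/
theorem child {s j : ℕ} (h : Covered e (s, j / 2)) : Covered e (s + 1, j) := by
  obtain ⟨m, hm, h1, h2, h3⟩ := h
  refine ⟨m, Nat.lt_succ_of_lt hm, ?_, h2.trans_le ?_, lt_of_le_of_lt ?_ h3⟩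
  · obtain ⟨x, hx⟩ := Option.isSome_iff_exists.1 h1
    exact Option.isSome_iff_exists.2 ⟨x, Nat.Partrec.Code.evaln_mono (Nat.le_succ s) hx⟩
  · have h4 : 2 * (j / 2) ≤ j := Nat.mul_div_le j 2
    have h5 : 2 * ((j / 2 : ℕ) : ℚ) ≤ j := by exact_mod_cast h4
    calc ((j / 2 : ℕ) : ℚ) * (1 / 2 ^ s) = 2 * ((j / 2 : ℕ) : ℚ) * (1 / 2 ^ (s + 1)) := by
          rw [pow_succ]; field_simp
      _ ≤ j * (1 / 2 ^ (s + 1)) := by gcongr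
  · have h4 : j + 1 ≤ 2 * (j / 2 + 1) := by omega
    have h5 : ((j + 1 : ℕ) : ℚ) ≤ 2 * ((j / 2 + 1 : ℕ) : ℚ) := by exact_mod_cast h4
    calc ((j + 1 : ℕ) : ℚ) * (1 / 2 ^ (s + 1))
        ≤ 2 * ((j / 2 + 1 : ℕ) : ℚ) * (1 / 2 ^ (s + 1)) := by gcongr
      _ = ((j / 2 + 1 : ℕ) : ℚ) * (1 / 2 ^ s) := by rw [pow_succ]; field_simp

theorem descendant {s d j : ℕ} (h : Covered e (s, j / 2 ^ d)) : Covered e (s + d, j) := by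
  induction d generalizing j with
  | zero => simpa using h
  | succ d ih =>
    refine child (ih ?_)
    rwa [Nat.div_div_eq_div_mul, mul_comm, ← pow_succ]

theorem of_mem_ceSet {p : PairCode} (hp : p ∈ ceSet e) :
    ∃ N, ∀ s ≥ N, ∀ j : ℕ, (ratOfCode p.1 : ℝ) < (j : ℝ) / 2 ^ s →
      ((j : ℝ) + 1) / 2 ^ s < (ratOfCode p.2 : ℝ) → Covered e (s, j) := by
  obtain ⟨x, hx⟩ := Part.dom_iff_mem.1 hp
  obtain ⟨k, hk⟩ := Nat.Partrec.Code.evaln_complete.1 hx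
  refine ⟨k, fun s hs j h1 h2 => ⟨Encodable.encode p, ?_, ?_, ?_, ?_⟩⟩
  · exact (Nat.Partrec.Code.evaln_bound hk).trans_le hs
  · exact Option.isSome_iff_exists.2 ⟨x, Nat.Partrec.Code.evaln_mono hs hk⟩
  · rw [Denumerable.ofNat_encode, ← Rat.cast_lt (K := ℝ)]
    push_cast
    rwa [mul_one_div]
  · rw [Denumerable.ofNat_encode, ← Rat.cast_lt (K := ℝ)]
    push_cast
    rwa [mul_one_div]

/-- Near a point of an effectively open set all dyadic intervals of large level are covered. -/
theorem eventually {y : ℝ} (hy : y ∈ sigmaSet e) : ∃ N, ∀ᶠ z in nhds y, ∀ s ≥ N, ∀ j : ℕ,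
    z ∈ Icc ((j : ℝ) / 2 ^ s) (((j : ℝ) + 1) / 2 ^ s) → Covered e (s, j) := by
  obtain ⟨p, hp, hy1, hy2⟩ := hy
  obtain ⟨N, hN⟩ := of_mem_ceSet hp
  obtain ⟨a, ha1, ha2⟩ := exists_between hy1
  obtain ⟨b, hb1, hb2⟩ := exists_between hy2
  have hε : 0 < min (a - ratOfCode p.1) (ratOfCode p.2 - b) :=
    lt_min (by linarith) (by linarith)
  obtain ⟨M, hM⟩ := exists_pow_lt_of_lt_one hε (one_half_lt_one (α := ℝ))
  refine ⟨max N M, ?_⟩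
  filter_upwards [Ioo_mem_nhds ha2 hb1] with z hz s hs j hj
  have h1 : (1 / 2 : ℝ) ^ s ≤ (1 / 2) ^ M :=
    pow_le_pow_of_le_one (by norm_num) (by norm_num) ((le_max_right _ _).trans hs)
  have h2 : ((j : ℝ) + 1) / 2 ^ s = (j : ℝ) / 2 ^ s + (1 / 2) ^ s := by
    rw [add_div, one_div_pow]
  obtain ⟨h3, h4⟩ := lt_min_iff.1 hM
  refine hN s ((le_max_left _ _).trans hs) j ?_ ?_
  · linarith [hj.2, hz.1]
  · linarith [hj.1, hz.2]

end Covered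

namespace Selected

variable {e : Nat.Partrec.Code}

/-- If the levels differed, the parent of the deeper cell would be the shallower cell or a
descendant of it, hence covered, against the selection of the deeper one. -/
theorem eq_of_mem_cell {i i' : ℕ × ℕ} (hi : Selected e i) (hi' : Selected e i') {y : ℝ}
    (hy : y ∈ cell i) (hy' : y ∈ cell i') : i = i' := by
  have key : ∀ i i' : ℕ × ℕ, Selected e i → Selected e i' → y ∈ cell i → y ∈ cell i' →
      ¬ i.1 < i'.1 := by
    rintro ⟨s, j⟩ ⟨s', j'⟩ hi hi' hy hy' (hlt : s < s')
    obtain ⟨d, rfl⟩ := Nat.exists_eq_add_of_lt hlt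
    refine hi'.2.2 ⟨by simp, ?_⟩
    have h1 : s + d + 1 - 1 = s + d := rfl
    simp only [h1]
    refine Covered.descendant ?_
    have h2 := (mem_cell_iff.1 hy).2
    have h3 := (mem_cell_iff.1 hy').2
    rw [Nat.div_div_eq_div_mul, ← pow_succ', ← h3, add_assoc, floor_mul_two_pow_add_div, h2]
    exact hi.2.1
  have h1 : i.1 = i'.1 := le_antisymm (not_lt.1 (key i' i hi' hi hy' hy))
    (not_lt.1 (key i i' hi hi' hy hy'))
  obtain ⟨s, j⟩ := i
  obtain ⟨s', j'⟩ := i'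
  obtain rfl : s = s' := h1
  rw [← (mem_cell_iff.1 hy).2, ← (mem_cell_iff.1 hy').2]

theorem cell_subset {i : ℕ × ℕ} (hi : Selected e i) : cell i ⊆ sigmaSet e :=
  Ico_subset_Icc_self.trans hi.2.1.closure_cell_subset

/-- Near a point of an effectively open set only selected intervals of bounded level occur. -/
theorem eventually_level_le {y : ℝ} (hy : y ∈ sigmaSet e) : ∃ N, ∀ᶠ z in nhds y, ∀ i,
    Selected e i → z ∈ cell i → i.1 ≤ N := by
  obtain ⟨N, hN⟩ := Covered.eventually hy
  refine ⟨N, hN.mono fun z hz i hi hzi => ?_⟩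
  obtain ⟨s, j⟩ := i
  by_contra! hlt
  obtain ⟨s, rfl⟩ : ∃ t, s = t + 1 := ⟨s - 1, by simp only at hlt; omega⟩
  refine hi.2.2 ⟨by simp, hz s (by simp only at hlt; omega) _ (Ico_subset_Icc_self ?_)⟩
  have h1 := mem_cell_iff.1 hzi
  have h2 := floor_mul_two_pow_add_div z s 1
  have h3 := mem_cell_floor s h1.1
  rw [← h2, h1.2, pow_one] at h3
  exact h3

/-- A covered closed interval around `y` of least level is selected, since its parent also contains
`y`. Closed intervals are needed for `y = 1`, which no half-open cell inside `[0,1]` contains. -/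
theorem exists_mem_Icc {y : ℝ} (hy : y ∈ sigmaSet e) (hy01 : y ∈ Icc (0 : ℝ) 1) : ∃ i,
    Selected e i ∧ y ∈ Icc ((i.2 : ℝ) / 2 ^ i.1) (((i.2 : ℝ) + 1) / 2 ^ i.1) := by
  classical
  have hex : ∃ s, ∃ j : ℕ, j < 2 ^ s ∧ y ∈ Icc ((j : ℝ) / 2 ^ s) (((j : ℝ) + 1) / 2 ^ s) ∧
      Covered e (s, j) := by
    obtain ⟨N, hN⟩ := Covered.eventually hy
    have hN := hN.self_of_nhds
    have h2 : (0 : ℝ) < 2 ^ N := by positivity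
    have hj : ∃ j : ℕ, j < 2 ^ N ∧ y ∈ Icc ((j : ℝ) / 2 ^ N) (((j : ℝ) + 1) / 2 ^ N) := by
      rcases hy01.2.eq_or_lt with rfl | hlt
      · refine ⟨2 ^ N - 1, Nat.sub_lt (by positivity) one_pos, ?_⟩
        have h3 : ((2 ^ N - 1 : ℕ) : ℝ) + 1 = 2 ^ N := by
          have : 2 ^ N - 1 + 1 = 2 ^ N := Nat.sub_add_cancel Nat.one_le_two_pow
          exact_mod_cast this
        rw [h3, div_self h2.ne', mem_Icc, div_le_one h2]
        exact ⟨by linarith, le_rfl⟩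
      · refine ⟨⌊y * 2 ^ N⌋₊, ?_, Ico_subset_Icc_self (mem_cell_floor N hy01.1)⟩
        rw [Nat.floor_lt (mul_nonneg hy01.1 h2.le)]
        push_cast
        exact (mul_lt_iff_lt_one_left h2).2 hlt
    obtain ⟨j, hj, hyj⟩ := hj
    exact ⟨N, j, hj, hyj, hN N le_rfl j hyj⟩
  obtain ⟨j, hj, hyj, hc⟩ := Nat.find_spec hex
  refine ⟨(Nat.find hex, j), ⟨hj, hc, ?_⟩, hyj⟩
  rintro ⟨h0 : 0 < Nat.find hex, hp⟩
  refine Nat.find_min hex (Nat.sub_lt h0 one_pos) ⟨j / 2, ?_, ?_, hp⟩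
  · rw [Nat.div_lt_iff_lt_mul two_pos, ← pow_succ, Nat.sub_add_cancel (m := 1) h0]
    exact hj
  · obtain ⟨t, ht⟩ : ∃ t, Nat.find hex = t + 1 := ⟨Nat.find hex - 1, by omega⟩
    rw [ht] at hyj
    rw [ht, Nat.add_sub_cancel]
    have h2 : (0 : ℝ) < 2 ^ t := by positivity
    rw [pow_succ, mem_Icc, div_le_iff₀ (by positivity), le_div_iff₀ (by positivity)] at hyj
    rw [mem_Icc, div_le_iff₀ h2, le_div_iff₀ h2]
    have h4 : 2 * (j / 2) ≤ j := Nat.mul_div_le j 2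
    have h5 : 2 * ((j / 2 : ℕ) : ℝ) ≤ j := by exact_mod_cast h4
    have h6 : j + 1 ≤ 2 * (j / 2 + 1) := by omega
    have h7 : (j : ℝ) + 1 ≤ 2 * (((j / 2 : ℕ) : ℝ) + 1) := by exact_mod_cast h6
    constructor <;> linarith [hyj.1, hyj.2]

/-- Near a boundary point of an effectively open set there are selected intervals. -/
theorem exists_cell_subset_ball {x : ℝ} (hx : x ∉ sigmaSet e)
    (hcl : ∀ ε > 0, ∃ y ∈ sigmaSet e, y ∈ Icc (0 : ℝ) 1 ∧ |y - x| < ε) {ε : ℝ} (hε : 0 < ε) :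
    ∃ i, Selected e i ∧ ∀ z ∈ cell i, |z - x| < ε := by
  obtain ⟨N, hN⟩ := exists_pow_lt_of_lt_one (half_pos hε) (one_half_lt_one (α := ℝ))
  -- The finitely many closed intervals of level at most `N` miss a neighbourhood of `x`. Selected
  -- cells met inside it are therefore shorter than `ε / 2`.
  set T : Set (ℕ × ℕ) := {i | Selected e i ∧ i.1 ≤ N} with hT
  have hfin : T.Finite := by
    refine ((Finset.range (N + 1)) ×ˢ (Finset.range (2 ^ N))).finite_toSet.subset ?_
    rintro ⟨s, j⟩ ⟨hi, hs⟩
    simp only [Finset.coe_product, Finset.coe_range, mem_prod, mem_Iio]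
    exact ⟨Nat.lt_succ_of_le hs, hi.1.trans_le (Nat.pow_le_pow_right two_pos hs)⟩
  have hclosed : IsClosed (⋃ i ∈ T, Icc ((i.2 : ℝ) / 2 ^ i.1) (((i.2 : ℝ) + 1) / 2 ^ i.1)) :=
    hfin.isClosed_biUnion fun _ _ => isClosed_Icc
  have hxn : x ∈ (⋃ i ∈ T, Icc ((i.2 : ℝ) / 2 ^ i.1) (((i.2 : ℝ) + 1) / 2 ^ i.1))ᶜ := by
    simp only [mem_compl_iff, mem_iUnion, not_exists]
    exact fun i hi h => hx (hi.1.2.1.closure_cell_subset h)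
  obtain ⟨δ, hδ, hball⟩ := Metric.isOpen_iff.1 hclosed.isOpen_compl x hxn
  obtain ⟨y, hyU, hy01, hyx⟩ := hcl (min δ (ε / 2)) (lt_min hδ (half_pos hε))
  rw [lt_min_iff] at hyx
  obtain ⟨i, hi, hyi⟩ := exists_mem_Icc hyU hy01
  refine ⟨i, hi, fun z hz => ?_⟩
  have hlevel : N ≤ i.1 := by
    by_contra! hlt
    refine hball (a := y) (by rw [Metric.mem_ball, Real.dist_eq]; exact hyx.1) ?_
    simp only [mem_iUnion]
    exact ⟨i, ⟨hi, hlt.le⟩, hyi⟩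
  have h1 : (1 / 2 : ℝ) ^ i.1 ≤ (1 / 2) ^ N :=
    pow_le_pow_of_le_one (by norm_num) (by norm_num) hlevel
  have h2 : ((i.2 : ℝ) + 1) / 2 ^ i.1 = (i.2 : ℝ) / 2 ^ i.1 + (1 / 2) ^ i.1 := by
    rw [add_div, one_div_pow]
  have hz' := Ico_subset_Icc_self hz
  have h3 := abs_lt.1 hyx.2
  rw [abs_lt]
  constructor <;> linarith [hz'.1, hz'.2, hyi.1, hyi.2]

end Selected

end DyadicCells

/-! ### The series of bumps: differentiability and discontinuity -/

section BumpSeries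

/-- The bump of level `s`, supported in an interval of length `1 / 4 ^ (s + 1)` in the middle half of
the dyadic interval `i = (s, j)`, differentiated `k ≤ n` times. -/
noncomputable def cellBump (n k : ℕ) (i : ℕ × ℕ) (y : ℝ) : ℝ :=
  (1 / 4 ^ (i.1 + 1)) ^ (n - k) *
    bumpDeriv n k ((y - (2 * i.2 + 1) / 2 ^ (i.1 + 1)) * 4 ^ (i.1 + 1))

open Classical in
/-- The sum of the bumps over the selected dyadic intervals, differentiated `k ≤ n` times. -/
noncomputable def bumpSeries (e : Nat.Partrec.Code) (n k : ℕ) (y : ℝ) : ℝ :=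
  ∑ᶠ i : ℕ × ℕ, if Selected e i then cellBump n k i y else 0

theorem bumpDeriv_eq_zero {n k : ℕ} {t : ℝ} (ht : t ∉ Ioo (0 : ℝ) 1) : bumpDeriv n k t = 0 :=
  if_neg ht

theorem hasDerivAt_cellBump {n k : ℕ} (hk : k < n) (i : ℕ × ℕ) (y : ℝ) :
    HasDerivAt (cellBump n k i) (cellBump n (k + 1) i y) y := by
  have h1 : HasDerivAt (fun y : ℝ => (y - (2 * i.2 + 1) / 2 ^ (i.1 + 1)) * 4 ^ (i.1 + 1))
      (1 * 4 ^ (i.1 + 1)) y := ((hasDerivAt_id y).sub_const _).mul_const _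
  have h2 := ((hasDerivAt_bumpDeriv hk _).comp y h1).const_mul ((1 / 4 ^ (i.1 + 1) : ℝ) ^ (n - k))
  refine h2.congr_deriv ?_
  have h3 : n - k = n - (k + 1) + 1 := by omega
  rw [cellBump, h3, pow_succ]
  field_simp

theorem abs_cellBump_le {n k : ℕ} (hk : k ≤ n) {C : ℝ}
    (hC : ∀ k ≤ n, ∀ t, |bumpDeriv n k t| ≤ C) (i : ℕ × ℕ) (y : ℝ) : |cellBump n k i y| ≤ C := by
  rw [cellBump, abs_mul, abs_of_nonneg (by positivity)]
  refine (mul_le_of_le_one_left (abs_nonneg _) (pow_le_one₀ (by positivity) ?_)).trans (hC k hk _)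
  exact (div_le_one (by positivity)).2 (one_le_pow₀ (by norm_num))

/-- Below order `n` at least one scaling factor `1 / 4^(s+1)`, the square of half the cell length,
survives. At order `n` none does. -/
theorem abs_cellBump_le_div {n k : ℕ} (hk : k < n) {C : ℝ}
    (hC : ∀ k ≤ n, ∀ t, |bumpDeriv n k t| ≤ C) (i : ℕ × ℕ) (y : ℝ) :
    |cellBump n k i y| ≤ C / 4 ^ (i.1 + 1) := by
  rw [cellBump, abs_mul, abs_of_nonneg (by positivity), div_eq_mul_one_div C, mul_comm]
  refine mul_le_mul (hC k hk.le _) ?_ (by positivity) ((abs_nonneg _).trans (hC k hk.le 0))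
  have h1 : (1 : ℝ) / 4 ^ (i.1 + 1) ≤ 1 :=
    (div_le_one (by positivity)).2 (one_le_pow₀ (by norm_num))
  exact pow_le_of_le_one (by positivity) h1 (Nat.sub_pos_of_lt hk).ne'

/-- The support of a bump lies in the middle half of its dyadic interval. -/
theorem mem_Icc_of_cellBump_ne_zero {n k : ℕ} {i : ℕ × ℕ} {y : ℝ} (h : cellBump n k i y ≠ 0) :
    y ∈ Icc ((i.2 : ℝ) / 2 ^ i.1 + 1 / 2 ^ (i.1 + 2)) (((i.2 : ℝ) + 1) / 2 ^ i.1 - 1 / 2 ^ (i.1 + 2))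
    := by
  have h1 : (y - (2 * i.2 + 1) / 2 ^ (i.1 + 1)) * 4 ^ (i.1 + 1) ∈ Ioo (0 : ℝ) 1 := by
    by_contra h2
    exact h (by rw [cellBump, bumpDeriv_eq_zero h2, mul_zero])
  obtain ⟨h2, h3⟩ := h1
  have hp : (0 : ℝ) < 4 ^ (i.1 + 1) := by positivity
  have h4 := pos_of_mul_pos_left h2 hp.le
  rw [← lt_div_iff₀ hp] at h3
  have h5 : (1 : ℝ) / 4 ^ (i.1 + 1) ≤ 1 / 2 ^ (i.1 + 2) := by
    refine one_div_le_one_div_of_le (by positivity) ?_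
    have h6 : (2 : ℝ) ^ (i.1 + 2) ≤ 2 ^ (2 * (i.1 + 1)) :=
      pow_le_pow_right₀ (by norm_num) (by omega)
    rwa [pow_mul, show (2 : ℝ) ^ 2 = 4 by norm_num] at h6
  have e1 : (2 * (i.2 : ℝ) + 1) / 2 ^ (i.1 + 1) = (i.2 : ℝ) / 2 ^ i.1 + 2 * (1 / 2 ^ (i.1 + 2)) := by
    rw [pow_add, pow_add]; field_simp
  have e2 : ((i.2 : ℝ) + 1) / 2 ^ i.1 = (i.2 : ℝ) / 2 ^ i.1 + 4 * (1 / 2 ^ (i.1 + 2)) := by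
    rw [pow_add]; field_simp; ring
  have h7 : (0 : ℝ) < 1 / 2 ^ (i.1 + 2) := by positivity
  rw [e1] at h3 h4
  rw [e2]
  constructor <;> linarith

theorem mem_cell_of_cellBump_ne_zero {n k : ℕ} {i : ℕ × ℕ} {y : ℝ} (h : cellBump n k i y ≠ 0) :
    y ∈ cell i := by
  have h1 := mem_Icc_of_cellBump_ne_zero h
  have h7 : (0 : ℝ) < 1 / 2 ^ (i.1 + 2) := by positivity
  exact ⟨by linarith [h1.1], by linarith [h1.2]⟩

variable {e : Nat.Partrec.Code} {n k : ℕ}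

theorem bumpSeries_eq_cellBump {i : ℕ × ℕ} (hi : Selected e i) {y : ℝ} (hy : y ∈ cell i) :
    bumpSeries e n k y = cellBump n k i y := by
  classical
  rw [bumpSeries, finsum_eq_single _ i, if_pos hi]
  intro i' hne
  split_ifs with h1
  · by_contra h2
    exact hne (h1.eq_of_mem_cell hi (mem_cell_of_cellBump_ne_zero h2) hy)
  · rfl

theorem bumpSeries_eq_zero {y : ℝ} (h : ∀ i, Selected e i → y ∉ cell i) :
    bumpSeries e n k y = 0 := by
  classical
  rw [bumpSeries]
  refine finsum_eq_zero_of_forall_eq_zero fun i => ?_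
  split_ifs with h1
  · by_contra h2
    exact h i h1 (mem_cell_of_cellBump_ne_zero h2)
  · rfl

theorem bumpSeries_eq_zero_of_notMem {y : ℝ} (hy : y ∉ sigmaSet e) : bumpSeries e n k y = 0 :=
  bumpSeries_eq_zero fun _ hi h => hy (hi.cell_subset h)

theorem abs_bumpSeries_le (hk : k ≤ n) {C : ℝ} (hC0 : 0 ≤ C)
    (hC : ∀ k ≤ n, ∀ t, |bumpDeriv n k t| ≤ C) (y : ℝ) : |bumpSeries e n k y| ≤ C := by
  by_cases h : ∃ i, Selected e i ∧ y ∈ cell i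
  · obtain ⟨i, hi, hy⟩ := h
    rw [bumpSeries_eq_cellBump hi hy]
    exact abs_cellBump_le hk hC i y
  · push Not at h
    rwa [bumpSeries_eq_zero h, abs_zero]

/-- The derivatives of order less than `n` vanish to second order outside the effectively open
set. -/
theorem abs_bumpSeries_le_sq (hk : k < n) {C : ℝ} (hC0 : 0 ≤ C)
    (hC : ∀ k ≤ n, ∀ t, |bumpDeriv n k t| ≤ C) {y : ℝ} (hy : y ∉ sigmaSet e) (z : ℝ) :
    |bumpSeries e n k z| ≤ 4 * C * (z - y) ^ 2 := by
  by_cases h0 : bumpSeries e n k z = 0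
  · rw [h0, abs_zero]; positivity
  by_cases h : ∃ i, Selected e i ∧ z ∈ cell i
  · obtain ⟨i, hi, hz⟩ := h
    rw [bumpSeries_eq_cellBump hi hz] at h0 ⊢
    refine (abs_cellBump_le_div hk hC i z).trans ?_
    have h1 := mem_Icc_of_cellBump_ne_zero h0
    have h2 : y ∉ Icc ((i.2 : ℝ) / 2 ^ i.1) (((i.2 : ℝ) + 1) / 2 ^ i.1) :=
      fun h => hy (hi.2.1.closure_cell_subset h)
    -- The bump lives in the middle half of its cell and `y` is outside the closed cell, so they are
    -- a quarter of the cell length apart.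
    have h3 : 1 / 2 ^ (i.1 + 2) ≤ |z - y| := by
      by_contra! h4
      rw [abs_lt] at h4
      exact h2 ⟨by linarith [h1.1], by linarith [h1.2]⟩
    have h5 : (1 / 2 ^ (i.1 + 2) : ℝ) ^ 2 ≤ (z - y) ^ 2 := by
      rw [← sq_abs (z - y)]
      gcongr
    calc C / 4 ^ (i.1 + 1) = 4 * C * (1 / 2 ^ (i.1 + 2)) ^ 2 := by
          rw [div_pow, ← pow_mul, mul_comm (i.1 + 2), pow_mul, show (2 : ℝ) ^ 2 = 4 by norm_num,
            pow_succ 4 (i.1 + 1)]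
          field_simp
      _ ≤ 4 * C * (z - y) ^ 2 := by gcongr
  · push Not at h
    exact absurd (bumpSeries_eq_zero h) h0

/-- On the open set the sum is locally finite; off it the quadratic bound makes the derivative zero.
This also covers `k + 1 = n`, where the derivative exists but may be discontinuous. -/
theorem hasDerivAt_bumpSeries (hk : k < n) (y : ℝ) :
    HasDerivAt (bumpSeries e n k) (bumpSeries e n (k + 1) y) y := by
  classical
  by_cases hy : y ∈ sigmaSet e
  · obtain ⟨N, hN⟩ := Selected.eventually_level_le hy
    set s := (Finset.range (N + 1)) ×ˢ (Finset.range (2 ^ N))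
    have key : ∀ k, ∀ᶠ z in nhds y, bumpSeries e n k z =
        ∑ i ∈ s, if Selected e i then cellBump n k i z else 0 := by
      intro k
      filter_upwards [hN] with z hz
      rw [bumpSeries]
      refine finsum_eq_sum_of_support_subset _ fun i hi => ?_
      rw [Function.mem_support] at hi
      have h1 : Selected e i := by
        by_contra h; exact hi (if_neg h)
      rw [if_pos h1] at hi
      have h2 := hz i h1 (mem_cell_of_cellBump_ne_zero hi)
      simp only [s, Finset.coe_product, Finset.coe_range, mem_prod, mem_Iio]
      exact ⟨Nat.lt_succ_of_le h2, h1.1.trans_le (Nat.pow_le_pow_right two_pos h2)⟩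
    rw [(key (k + 1)).self_of_nhds]
    refine HasDerivAt.congr_of_eventuallyEq ?_ (key k)
    refine HasDerivAt.fun_sum fun i _ => ?_
    split_ifs
    · exact hasDerivAt_cellBump hk i y
    · exact hasDerivAt_const y 0
  · obtain ⟨C, hC0, hC⟩ := exists_forall_abs_bumpDeriv_le n
    rw [bumpSeries_eq_zero_of_notMem hy, hasDerivAt_iff_isLittleO]
    simp only [bumpSeries_eq_zero_of_notMem hy, sub_zero, smul_zero]
    have h1 : (fun z => bumpSeries e n k z) =O[nhds y] fun z => (z - y) ^ 2 :=
      Asymptotics.IsBigO.of_bound (4 * C) (Filter.Eventually.of_forall fun z => by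
        rw [Real.norm_eq_abs, Real.norm_eq_abs, abs_of_nonneg (sq_nonneg (z - y))]
        exact abs_bumpSeries_le_sq hk hC0.le hC hy z)
    refine h1.trans_isLittleO ?_
    have h2 : Filter.Tendsto (fun z : ℝ => z - y) (nhds y) (nhds 0) :=
      tendsto_sub_nhds_zero_iff.2 Filter.tendsto_id
    exact (Asymptotics.isLittleO_pow_id one_lt_two).comp_tendsto h2

/-- The first derivative is bounded because `n ≥ 1`; the Lipschitz constant serves as a modulus of
continuity for computability. -/
theorem exists_forall_abs_bumpSeries_sub_le (hn : 1 ≤ n) :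
    ∃ L : ℕ, ∀ y z, |bumpSeries e n 0 y - bumpSeries e n 0 z| ≤ L * |y - z| := by
  obtain ⟨C, hC0, hC⟩ := exists_forall_abs_bumpDeriv_le n
  obtain ⟨L, hL⟩ := exists_nat_ge C
  refine ⟨L, fun y z => ?_⟩
  exact convex_univ.norm_image_sub_le_of_norm_hasDerivWithin_le (f := bumpSeries e n 0)
    (f' := bumpSeries e n 1) (fun w _ => (hasDerivAt_bumpSeries hn w).hasDerivWithinAt)
    (fun w _ => (abs_bumpSeries_le hn hC0.le hC w).trans hL) (mem_univ z) (mem_univ y)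

/-- The restriction of the bump series to `[0,1]`. -/
noncomputable def bumpFun (e : Nat.Partrec.Code) (n : ℕ) (y : unitInterval) : ℝ :=
  bumpSeries e n 0 y

theorem iteratedDerivWithin_bumpFun (hk : k ≤ n) {y : ℝ} (hy : y ∈ Icc (0 : ℝ) 1) :
    iteratedDerivWithin k (IccExtend (zero_le_one' ℝ) (bumpFun e n)) (Icc 0 1) y =
      bumpSeries e n k y := by
  induction k generalizing y with
  | zero => rw [iteratedDerivWithin_zero, IccExtend_of_mem _ _ hy]; rfl
  | succ k ih =>
    rw [iteratedDerivWithin_succ,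
      derivWithin_congr (fun z hz => ih (by omega) hz) (ih (by omega) hy)]
    exact (hasDerivAt_bumpSeries hk y).hasDerivWithinAt.derivWithin
      (uniqueDiffOn_Icc zero_lt_one y hy)

theorem nTimesDifferentiable_bumpFun (e : Nat.Partrec.Code) (n : ℕ) :
    NTimesDifferentiable n (bumpFun e n) := fun _ hk y hy =>
  ((hasDerivAt_bumpSeries hk y).differentiableAt.differentiableWithinAt).congr
    (fun _ hz => iteratedDerivWithin_bumpFun hk.le hz) (iteratedDerivWithin_bumpFun hk.le hy)

theorem nthDeriv_bumpFun (y : unitInterval) : nthDeriv n (bumpFun e n) y = bumpSeries e n n y :=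
  iteratedDerivWithin_bumpFun le_rfl y.2

/-- The `n`-th derivative of the bump series is discontinuous at the boundary points of the
effectively open set. -/
theorem not_continuousAt_nthDeriv_bumpFun {x : unitInterval} (hx : x ∉ sigmaClass e)
    (hcl : x ∈ closure (sigmaClass e)) : ¬ ContinuousAt (nthDeriv n (bumpFun e n)) x := by
  intro hcont
  obtain ⟨t, ht, htne⟩ := exists_bumpDeriv_ne_zero n
  obtain ⟨δ, hδ, h1⟩ := Metric.continuousAt_iff.1 hcont _ (abs_pos.2 htne)
  obtain ⟨i, hi, hball⟩ := Selected.exists_cell_subset_ball (e := e) hx (fun ε hε => by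
    obtain ⟨y, hy, hyx⟩ := Metric.mem_closure_iff.1 hcl ε hε
    exact ⟨y, hy, y.2, by rwa [dist_comm, Subtype.dist_eq, Real.dist_eq] at hyx⟩) hδ
  -- The point of the cell with bump coordinate `t`: the `n`-th derivative takes the same value
  -- there at every level.
  set z : ℝ := (2 * i.2 + 1) / 2 ^ (i.1 + 1) + t / 4 ^ (i.1 + 1) with hz
  have h2 : cellBump n n i z = bumpDeriv n n t := by
    have h3 : (z - (2 * i.2 + 1) / 2 ^ (i.1 + 1)) * 4 ^ (i.1 + 1) = t := by
      rw [hz]; field_simp; ring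
    rw [cellBump, h3, Nat.sub_self, pow_zero, one_mul]
  have hzc : z ∈ cell i := mem_cell_of_cellBump_ne_zero (n := n) (k := n) (by rwa [h2])
  have hz01 : z ∈ Icc (0 : ℝ) 1 := by
    refine ⟨le_trans (by positivity) hzc.1, hzc.2.le.trans ?_⟩
    rw [div_le_one (by positivity)]
    exact_mod_cast hi.1
  have h4 := h1 (x := ⟨z, hz01⟩) (by rw [Subtype.dist_eq, Real.dist_eq]; exact hball z hzc)
  rw [nthDeriv_bumpFun, nthDeriv_bumpFun, bumpSeries_eq_zero_of_notMem (y := (x : ℝ)) hx,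
    bumpSeries_eq_cellBump hi hzc, h2, Real.dist_eq, sub_zero] at h4
  exact lt_irrefl _ h4

end BumpSeries

/-! ### Computability of the bump series -/

section Computability

/-- The level of the cell bounds both the search for `m` and the running time. -/
theorem primrecPred_covered (e : Nat.Partrec.Code) : PrimrecPred (Covered e) := by
  have hp : Primrec fun x : ℕ × (ℕ × ℕ) => (Denumerable.ofNat PairCode x.1 : PairCode) :=
    (Primrec.ofNat PairCode).comp Primrec.fst
  have hs : Primrec fun x : ℕ × (ℕ × ℕ) => x.2.1 := Primrec.fst.comp Primrec.snd
  have hj : Primrec fun x : ℕ × (ℕ × ℕ) => x.2.2 := Primrec.snd.comp Primrec.snd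
  have h1 : PrimrecPred fun x : ℕ × (ℕ × ℕ) =>
      (Nat.Partrec.Code.evaln x.2.1 e x.1).isSome = true :=
    Primrec.eq.comp (Primrec.option_isSome.comp (Nat.Partrec.Code.primrec_evaln.comp
      ((hs.pair (Primrec.const e)).pair Primrec.fst))) (Primrec.const true)
  have h2 := (primrecRat_ratOfCode.comp (Primrec.fst.comp hp)).lt
    ((PrimrecRat.natCast hj).mul (PrimrecRat.one_div_two_pow hs))
  have h3 := ((PrimrecRat.natCast (Primrec.succ.comp hj)).mul (PrimrecRat.one_div_two_pow hs)).lt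
    (primrecRat_ratOfCode.comp (Primrec.snd.comp hp))
  have h4 := (PrimrecPred.primrecRel (h1.and (h2.and h3))).exists_mem_list
  refine (h4.comp (Primrec.list_range.comp Primrec.fst) Primrec.id).of_eq fun i => ?_
  simp only [List.mem_range]
  rfl

theorem primrecPred_selected (e : Nat.Partrec.Code) : PrimrecPred (Selected e) := by
  have hpow : Primrec fun i : ℕ × ℕ => 2 ^ i.1 :=
    (Primrec₂.unpaired'.1 Nat.Primrec.pow).comp (Primrec.const 2) Primrec.fst
  refine (Primrec.nat_lt.comp Primrec.snd hpow).and ((primrecPred_covered e).and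
    (PrimrecPred.not ((Primrec.nat_lt.comp (Primrec.const 0) Primrec.fst).and
      ((primrecPred_covered e).comp ?_))))
  exact (Primrec.nat_sub.comp Primrec.fst (Primrec.const 1)).pair
    (Primrec.nat_div.comp Primrec.snd (Primrec.const 2))

/-- The coordinate of the dyadic rational `k / 2 ^ m` relative to the support of the bump of level
`i = (s, j)`. -/
def bumpCoord (m k : ℕ) (i : ℕ × ℕ) : ℚ :=
  ((k : ℚ) * (1 / 2 ^ m) - ((2 * i.2 + 1 : ℕ) : ℚ) * (1 / 2 ^ (i.1 + 1))) * ((4 ^ (i.1 + 1) : ℕ) : ℚ)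

open Classical in
/-- The value of the bump series at the dyadic rational `k / 2 ^ m`. -/
noncomputable def dyadicValue (e : Nat.Partrec.Code) (n m k : ℕ) : ℚ :=
  ∑ s ∈ Finset.range m, if Selected e (s, k / 2 ^ (m - s)) then
    (1 / 2 ^ (2 * (s + 1))) ^ n * max 0 (bumpCoord m k (s, k / 2 ^ (m - s)) *
      (1 - bumpCoord m k (s, k / 2 ^ (m - s)))) ^ (n + 1) else 0

theorem primrecRat_dyadicValue (e : Nat.Partrec.Code) (n : ℕ) :
    PrimrecRat fun a : ℕ × ℕ => dyadicValue e n a.1 a.2 := by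
  classical
  have hpow : Primrec₂ fun a b : ℕ => a ^ b := Primrec₂.unpaired'.1 Nat.Primrec.pow
  have hm : Primrec fun x : (ℕ × ℕ) × ℕ => x.1.1 := Primrec.fst.comp Primrec.fst
  have hk : Primrec fun x : (ℕ × ℕ) × ℕ => x.1.2 := Primrec.snd.comp Primrec.fst
  have hs : Primrec fun x : (ℕ × ℕ) × ℕ => x.2 := Primrec.snd
  have hj : Primrec fun x : (ℕ × ℕ) × ℕ => x.1.2 / 2 ^ (x.1.1 - x.2) :=
    Primrec.nat_div.comp hk (hpow.comp (Primrec.const 2) (Primrec.nat_sub.comp hm hs))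
  have hs1 := Primrec.succ.comp hs
  have hc : PrimrecRat fun x : (ℕ × ℕ) × ℕ =>
      bumpCoord x.1.1 x.1.2 (x.2, x.1.2 / 2 ^ (x.1.1 - x.2)) :=
    (((PrimrecRat.natCast hk).mul (PrimrecRat.one_div_two_pow hm)).sub
      ((PrimrecRat.natCast (Primrec.succ.comp (Primrec.nat_mul.comp (Primrec.const 2) hj))).mul
        (PrimrecRat.one_div_two_pow hs1))).mul
      (PrimrecRat.natCast (hpow.comp (Primrec.const 4) hs1))
  refine PrimrecRat.sum_range (α := ℕ × ℕ) (PrimrecRat.ite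
    ((primrecPred_selected e).comp (hs.pair hj)) (PrimrecRat.mul ?_ ?_) (PrimrecRat.const 0))
    Primrec.fst
  · exact (PrimrecRat.one_div_two_pow (Primrec.nat_mul.comp (Primrec.const 2) hs1)).pow n
  · exact ((PrimrecRat.const 0).max (hc.mul ((PrimrecRat.const 1).sub hc))).pow (n + 1)

theorem cellBump_dyadic (n m k : ℕ) (i : ℕ × ℕ) :
    cellBump n 0 i ((k : ℝ) / 2 ^ m) = (((1 / 2 ^ (2 * (i.1 + 1))) ^ n *
      max 0 (bumpCoord m k i * (1 - bumpCoord m k i)) ^ (n + 1) : ℚ) : ℝ) := by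
  have h1 : ((k : ℝ) / 2 ^ m - (2 * i.2 + 1) / 2 ^ (i.1 + 1)) * 4 ^ (i.1 + 1) =
      (bumpCoord m k i : ℝ) := by
    rw [bumpCoord]; push_cast; simp only [mul_one_div]
  rw [cellBump, h1, bumpDeriv_zero_eq, pow_mul, show (2 : ℚ) ^ 2 = 4 by norm_num, Nat.sub_zero]
  push_cast
  rfl

theorem floor_dyadic (k s d : ℕ) : ⌊(k : ℝ) / 2 ^ (s + d) * 2 ^ s⌋₊ = k / 2 ^ d := by
  have h1 : (k : ℝ) / 2 ^ (s + d) * 2 ^ s = (k : ℝ) / ((2 ^ d : ℕ) : ℝ) := by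
    push_cast
    rw [pow_add]
    field_simp
  rw [h1, Nat.floor_div_natCast, Nat.floor_natCast]

/-- The bumps of level at least `m` vanish at the multiples of `1 / 2 ^ m`. -/
theorem cellBump_dyadic_eq_zero {n l m k : ℕ} {i : ℕ × ℕ} (hm : m ≤ i.1) :
    cellBump n l i ((k : ℝ) / 2 ^ m) = 0 := by
  obtain ⟨s, j⟩ := i
  obtain ⟨d, rfl⟩ := Nat.exists_eq_add_of_le hm
  by_contra h
  have h1 := (mem_cell_iff.1 (mem_cell_of_cellBump_ne_zero h)).2
  have h2 := (mem_Icc_of_cellBump_ne_zero h).1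
  have h3 : (k : ℝ) / 2 ^ m * 2 ^ (m + d) = ((k * 2 ^ d : ℕ) : ℝ) := by
    push_cast
    rw [pow_add]
    field_simp
  rw [h3, Nat.floor_natCast] at h1
  -- A multiple of `1 / 2^m` is the left endpoint of its cell at any level from `m` on, outside the
  -- middle half.
  have h4 : (j : ℝ) / 2 ^ (m + d) = (k : ℝ) / 2 ^ m := by
    rw [← h1, ← h3]
    field_simp
  simp only [h4] at h2
  have h5 : (0 : ℝ) < 1 / 2 ^ (m + d + 2) := by positivity
  linarith

/-- Only levels `s < m` can contribute at this point, and at each of them only the cell with index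
`k / 2^(m-s)` (integer division) contains it. -/
theorem bumpSeries_dyadic (e : Nat.Partrec.Code) (n m k : ℕ) :
    bumpSeries e n 0 ((k : ℝ) / 2 ^ m) = (dyadicValue e n m k : ℝ) := by
  classical
  set y : ℝ := (k : ℝ) / 2 ^ m with hy
  have hy0 : 0 ≤ y := by positivity
  have hcell : ∀ s < m, y ∈ cell (s, k / 2 ^ (m - s)) := by
    intro s hs
    have h1 := floor_dyadic k s (m - s)
    rw [Nat.add_sub_cancel' hs.le] at h1
    exact mem_cell_iff.2 ⟨hy0, h1⟩
  have hval : (dyadicValue e n m k : ℝ) = ∑ s ∈ Finset.range m,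
      if Selected e (s, k / 2 ^ (m - s)) then cellBump n 0 (s, k / 2 ^ (m - s)) y else 0 := by
    rw [dyadicValue, Rat.cast_sum]
    refine Finset.sum_congr rfl fun s _ => ?_
    split_ifs
    · rw [hy, cellBump_dyadic]
    · exact Rat.cast_zero
  rw [hval]
  by_cases h : ∃ i, Selected e i ∧ y ∈ cell i
  · obtain ⟨⟨s, j⟩, hi, hyi⟩ := h
    rw [bumpSeries_eq_cellBump hi hyi]
    have hother : ∀ t ∈ Finset.range m, t ≠ s →
        (if Selected e (t, k / 2 ^ (m - t)) then cellBump n 0 (t, k / 2 ^ (m - t)) y else 0) = 0 := by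
      intro t ht hts
      rw [if_neg]
      intro h1
      exact hts (congrArg Prod.fst (h1.eq_of_mem_cell hi (hcell t (Finset.mem_range.1 ht)) hyi))
    by_cases hs : s < m
    · rw [Finset.sum_eq_single_of_mem s (Finset.mem_range.2 hs) hother]
      have h1 : k / 2 ^ (m - s) = j :=
        (mem_cell_iff.1 (hcell s hs)).2.symm.trans (mem_cell_iff.1 hyi).2
      rw [h1, if_pos hi]
    · rw [cellBump_dyadic_eq_zero (not_lt.1 hs), Finset.sum_eq_zero]
      exact fun t ht => hother t ht fun hts => hs (hts ▸ Finset.mem_range.1 ht)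
  · push Not at h
    rw [bumpSeries_eq_zero h, Finset.sum_eq_zero]
    exact fun s hs => if_neg fun h1 => h _ h1 (hcell s (Finset.mem_range.1 hs))

/-- A Lipschitz function whose values at the dyadic rationals are uniformly primitive recursive
rationals is computable. -/
theorem isComputable_of_lipschitz {F : ℝ → ℝ} {L : ℕ} (hL : ∀ y z, |F y - F z| ≤ L * |y - z|)
    {v : ℕ × ℕ → ℚ} (hv : PrimrecRat v) (hF : ∀ m k : ℕ, F ((k : ℝ) / 2 ^ m) = v (m, k)) :
    IsComputable fun y : unitInterval => F y := by
  have hx1 : Primrec fun x : PairCode × (ℕ × ℕ) => x.2.1 := Primrec.fst.comp Primrec.snd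
  have hw := PrimrecRat.one_div_two_pow hx1
  have hc := (PrimrecRat.natCast
    (Primrec.snd.comp Primrec.snd : Primrec fun x : PairCode × (ℕ × ℕ) => x.2.2)).mul hw
  have hv' := hv.comp (Primrec.snd : Primrec fun x : PairCode × (ℕ × ℕ) => x.2)
  have hLw := (PrimrecRat.const (L : ℚ)).mul hw
  -- The interval of radius `1 / 2^m` about `k / 2^m` is enumerated once the value at its centre,
  -- with error `L / 2^m`, is seen to lie in the target.
  have h1 := (primrecRat_ratOfCode.comp
    (Primrec.fst.comp Primrec.fst : Primrec fun x : PairCode × (ℕ × ℕ) => x.1.1)).lt (hv'.sub hLw)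
  have h2 := (hv'.add hLw).lt (primrecRat_ratOfCode.comp
    (Primrec.snd.comp Primrec.fst : Primrec fun x : PairCode × (ℕ × ℕ) => x.1.2))
  obtain ⟨g1, hg1, hg1'⟩ := hc.sub hw
  obtain ⟨g2, hg2, hg2'⟩ := hc.add hw
  have hS := ((UniformlySigma.ratIoo (hg1.pair hg2)).inter
    (UniformlySigma.setOf_const (h1.and h2).rePred)).iUnion
  refine hS.isComputable fun p y => ?_
  simp only [mem_iUnion, mem_inter_iff, mem_ofPred_eq, mem_ratIoo, hg1', hg2']
  have hcast : ∀ m k : ℕ, (((k : ℚ) * (1 / 2 ^ m) : ℚ) : ℝ) = (k : ℝ) / 2 ^ m := fun m k => by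
    push_cast; rw [mul_one_div]
  have hcast' : ∀ m : ℕ, ((1 / 2 ^ m : ℚ) : ℝ) = 1 / 2 ^ m := fun m => by push_cast; rfl
  constructor
  · rintro ⟨hp1, hp2⟩
    -- The error `L / 2^m` enters twice, between `F y` and the value at the centre and again in the
    -- enumeration test; the extra `1` keeps the denominator positive and lets `y` itself be handled
    -- when `L = 0`.
    have hε : 0 < min (F y - ratOfCode p.1) (ratOfCode p.2 - F y) / (2 * L + 1) :=
      div_pos (lt_min (by linarith) (by linarith)) (by positivity)
    obtain ⟨m, hm⟩ := exists_pow_lt_of_lt_one hε (one_half_lt_one (α := ℝ))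
    rw [lt_div_iff₀ (by positivity), one_div_pow, lt_min_iff] at hm
    have hw0 : (0 : ℝ) < 1 / 2 ^ m := by positivity
    have hy := mem_cell_floor m y.2.1
    set k := ⌊(y : ℝ) * 2 ^ m⌋₊
    obtain ⟨hy1, hy2⟩ := hy
    simp only [add_div] at hy1 hy2
    have h3 := hL y ((k : ℝ) / 2 ^ m)
    rw [hF] at h3
    have h4 : |(y : ℝ) - (k : ℝ) / 2 ^ m| ≤ 1 / 2 ^ m := by
      rw [abs_le]; constructor <;> linarith
    have h5 := abs_le.1 (h3.trans (mul_le_mul_of_nonneg_left h4 (Nat.cast_nonneg L)))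
    refine ⟨(m, k), ⟨?_, ?_⟩, ?_, ?_⟩
    · rw [Rat.cast_sub, hcast, hcast']; linarith
    · rw [Rat.cast_add, hcast, hcast']; linarith
    · rw [← Rat.cast_lt (K := ℝ), Rat.cast_sub, Rat.cast_mul, hcast', Rat.cast_natCast]
      linarith [h5.2]
    · rw [← Rat.cast_lt (K := ℝ), Rat.cast_add, Rat.cast_mul, hcast', Rat.cast_natCast]
      linarith [h5.1]
  · rintro ⟨⟨m, k⟩, ⟨h3, h4⟩, h5, h6⟩
    rw [Rat.cast_sub, hcast, hcast'] at h3
    rw [Rat.cast_add, hcast, hcast'] at h4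
    rw [← Rat.cast_lt (K := ℝ), Rat.cast_sub, Rat.cast_mul, hcast', Rat.cast_natCast] at h5
    rw [← Rat.cast_lt (K := ℝ), Rat.cast_add, Rat.cast_mul, hcast', Rat.cast_natCast] at h6
    have h7 := hL y ((k : ℝ) / 2 ^ m)
    rw [hF] at h7
    have h8 : |(y : ℝ) - (k : ℝ) / 2 ^ m| ≤ 1 / 2 ^ m := by
      rw [abs_le]; constructor <;> linarith
    have h9 := abs_le.1 (h7.trans (mul_le_mul_of_nonneg_left h8 (Nat.cast_nonneg L)))
    constructor <;> linarith [h9.1, h9.2]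

theorem isComputable_bumpFun (e : Nat.Partrec.Code) {n : ℕ} (hn : 1 ≤ n) :
    IsComputable (bumpFun e n) := by
  obtain ⟨L, hL⟩ := exists_forall_abs_bumpSeries_sub_le (e := e) hn
  exact isComputable_of_lipschitz hL (primrecRat_dyadicValue e n) fun m k =>
    bumpSeries_dyadic e n m k

end Computability
end EffReal

/-! ### The equivalence -/

theorem mainTheorem4 (n : ℕ) (hn : 1 ≤ n) (x : unitInterval) :
    EffReal.IsOneGeneric x ↔
      ∀ f : unitInterval → ℝ, EffReal.IsComputable f → EffReal.NTimesDifferentiable n f →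
        ContinuousAt (EffReal.nthDeriv n f) x := by
  refine ⟨fun hx f hf hd => hx.continuousAt_nthDeriv hn hf hd, fun h V hV hx => ?_⟩
  obtain ⟨e, he⟩ := hV
  refine EffReal.not_continuousAt_nthDeriv_bumpFun (e := e) (n := n) ?_ ?_
    (h _ (EffReal.isComputable_bumpFun e hn) (EffReal.nTimesDifferentiable_bumpFun e n))
  · rw [← he]
    exact fun hc => hc hx.1
  · rw [← he, closure_compl]
    exact hx.2
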